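/- **Setting.** Let $U\subset\mathbb R^m$ be compact, let $G,G_1\subseteq\mathbb R^n$ be open and connected with $\bar G\subset G_1$ and $0\in G$, and let $f:G_1\times U\to\mathbb R^n$ be continuous. Consider $$\dot x(t)=f(x(t),u(t)),\quad x(0)=x_0\in G,\quad u(\cdot)\in\mathcal U:=L^\infty_{\rm loc}([0,+\infty),U),$$ whose (Carathéodory) solution is written $x(t;x_0,u(\cdot))$. Balls are Euclidean: $\mathrm B_R(0)$ is open and $\bar{\mathrm B}_R(0)$ is closed. $\mathcal K$ is the class of strictly increasing continuous $\varphi:[0,\infty)\to[0,\infty)$ with $\varphi(0)=0$; $\mathcal K_\infty$ consists of those $\varphi\in\mathcal K$ with $\varphi(\rho)\to\infty$ as $\rho\to\infty$; $\mathcal{KL}$ is the class of continuous $\beta:[0,\infty)^2\to[0,\infty)$ such that $\beta(\cdot,t)\in\mathcal K$ for every $t\ge 0$ and, for every $\rho\ge 0$, $\beta(\rho,\cdot)$ is nonincreasing with limit $0$ at $+\infty$. **Assumptions.** (A) *System.* - Any trajectory of the system on an interval $[0,T)$, $T\in(0,+\infty]$, with $x_0\in G$ and $u(\cdot)\in\mathcal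 U$, stays inside $G$. - For every $R>0$ there is $C_{1,R}>0$ with $\|f(x,u)-f(x',u)\|\le C_{1,R}\|x-x'\|$ for all $x,x'\in\bar{\mathrm B}_R(0)\cap\bar G$ and $u\in U$. - There are a $C^1$ function $Y:G_1\to[0,\infty)$, proper in the sense that preimages of compact subsets of $\mathbb R$ are compact, and a constant $C_2>0$ with $\sup_{u\in U}\langle \mathrm DY(x),f(x,u)\rangle\le C_2Y(x)$ for all $x\in G_1$. (B) *Local asymptotic null-controllability.* $0\in U$ and $f(0,0)=0$. There are $r>0$ with $\bar{\mathrm B}_r(0)\subset G$, $\bar u>0$, $\beta\in\mathcal{KL}$ and $\alpha_1,\alpha_2\in\mathcal K_\infty$ with $\beta(\rho,t)\le\alpha_2(\alpha_1(\rho)e^{-t})$ for all $\rho,t\ge0$, and constants $C_{11},C_{12}>0$, such that at least one of the following holds, where $g$ is the running cost of (C): 1. for every $x_0\in \mathrm B_r(0)$ there is $u_{x_0}(\cdot)\in\mathcal U$ with $\|u_{x_0}\|_{L^\infty}\le\bar u$ and $\|x(t;x_0,u_{x_0}(\cdot))\|\le\beta(\|x_0\|,t)$ for all $t\ge0$; moreover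 $g(x,u)\le C_{11}\big(\alpha_2^{-1}(\|x\|)\big)^{C_{12}}$ for all $x\in\bar{\mathrm B}_r(0)$ and $u\in\bar{\mathrm B}_{\bar u}(0)\cap U$; 2. (small control property) $\bar u=\beta(r,0)$, and for every $x_0\in \mathrm B_r(0)$ there is $u_{x_0}(\cdot)\in\mathcal U$ with $\|x(t;x_0,u_{x_0}(\cdot))\|+\|u_{x_0}(t)\|\le\beta(\|x_0\|,t)$ for almost all $t\ge0$; moreover $g(x,u)\le C_{11}\big(\alpha_2^{-1}(\|x\|+\|u\|)\big)^{C_{12}}$ for all $x\in\bar{\mathrm B}_r(0)$ and $u\in\bar{\mathrm B}_{\bar u}(0)\cap U$. (C) *Running cost.* - $g:\bar G\times U\to[0,\infty)$ is continuous, and for every $R>0$ there is $C_{5,R}>0$ with $|g(x,u)-g(x',u)|\le C_{5,R}\|x-x'\|$ for all $x,x'\in\bar{\mathrm B}_R(0)\cap\bar G$ and $u\in U$. - For every $R>0$, $\inf\{g(x,u):(x,u)\in\bar G\times U,\ \|x\|\ge R\}>0$. - There is $C_{13}>0$ with $g(x,u)\ge C_{13}\|f(x,u)\|$ for all $(x,u)\in\bar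 G\times U$ such that $\|x\|\ge2r$ or $\|u\|\ge2\bar u$. **Definitions.** Let $\mathcal D_0$ be the set of all $x_0\in G$ for which there is $u(\cdot)\in\mathcal U$ with $\lim_{t\to+\infty}\|x(t;x_0,u(\cdot))\|=0$. For $x_0\in G$ and $\delta\in(0,r]$ put (with $\inf\emptyset=+\infty$ and $e^{-(+\infty)}=0$) $$V_0(x_0)=\inf_{u(\cdot)\in\mathcal U}\int_0^{+\infty}g(x(t;x_0,u(\cdot)),u(t))\,\mathrm dt,$$ $$V_\delta(x_0)=\inf\Big\{\int_0^Tg(x(t;x_0,u(\cdot)),u(t))\,\mathrm dt:\ u(\cdot)\in\mathcal U,\ T\in[0,+\infty),\ x(T;x_0,u(\cdot))\in\bar{\mathrm B}_\delta(0)\Big\},$$ and $v_\delta(x_0)=1-e^{-V_\delta(x_0)}\in[0,1]$ for $\delta\in[0,r]$. **Theorem.** Under (A), (B) and (C): 1. $\mathcal D_0=\{x_0\in G: V_\delta(x_0)<+\infty\}=\{x_0\in G: v_\delta(x_0)<1\}$ for every $\delta\in[0,r]$. 2. $v_\delta\to v_0$ uniformly on $G$ as $\delta\to+0$. 3. $V_\delta\to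 V_0$ uniformly on every compact subset of $\mathcal D_0$ as $\delta\to+0$. 4. For every $\delta\in(0,r]$, if the Petrov condition $\min_{u\in U}\langle x,f(x,u)\rangle<0$ holds for all $x$ with $\|x\|=\delta$, then $V_\delta$ is locally Lipschitz continuous in $\mathcal D_0$, and therefore differentiable at almost every point of $\mathcal D_0$ with respect to the Lebesgue measure. -/

import Mathlib

open Set Filter Topology MeasureTheory
open scoped ENNReal

namespace ExitTime

/-- The column vectors of dimension `k`, with the Euclidean norm. -/
abbrev Vec (k : ℕ) := EuclideanSpace ℝ (Fin k)

/-- The data of the optimal control problems: the control set `U`, the domains `G` and `G₁` in the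
state space, the right-hand side `f` (relevant on `G₁ × U`) and the running cost `g` (relevant on
`closure G × U`). -/
structure Data (n m : ℕ) where
  U : Set (Vec m)
  G : Set (Vec n)
  G₁ : Set (Vec n)
  f : Vec n → Vec m → Vec n
  g : Vec n → Vec m → ℝ

variable {n m : ℕ}

/-- The class `L^∞_loc([0, ∞), U)` of control strategies. -/
def Data.IsControl (S : Data n m) (u : ℝ → Vec m) : Prop :=
  (∀ t, 0 ≤ t → u t ∈ S.U) ∧ ∀ T : ℝ, MemLp u ∞ (volume.restrict (Icc 0 T))

/-- `x` is a (Caratheodory) solution on `[0, T)`, `T ∈ (0, ∞]`, of `x' = f(x, u)`, `x(0) = x₀`,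
with values in the domain `G₁` of `f`. Taking `t = 0` gives `x 0 = x₀`. -/
def Data.IsTrajectory (S : Data n m) (T : ℝ≥0∞) (x₀ : Vec n) (u : ℝ → Vec m)
    (x : ℝ → Vec n) : Prop :=
  ContinuousOn x {t | 0 ≤ t ∧ ENNReal.ofReal t < T} ∧
  ∀ t, 0 ≤ t → ENNReal.ofReal t < T →
    x t ∈ S.G₁ ∧ IntervalIntegrable (fun s => S.f (x s) (u s)) volume 0 t ∧
    x t = x₀ + ∫ s in (0 : ℝ)..t, S.f (x s) (u s)

/-- The standing assumptions on the control system. -/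
structure Data.Regular (S : Data n m) : Prop where
  compact_U : IsCompact S.U
  open_G : IsOpen S.G
  connected_G : IsConnected S.G
  open_G₁ : IsOpen S.G₁
  connected_G₁ : IsConnected S.G₁
  closure_subset : closure S.G ⊆ S.G₁
  zero_mem : (0 : Vec n) ∈ S.G
  continuous_f : ContinuousOn (fun p : Vec n × Vec m => S.f p.1 p.2) (S.G₁ ×ˢ S.U)
  /-- strong invariance of `G` -/
  invariant : ∀ (T : ℝ≥0∞) (x₀ : Vec n) (u : ℝ → Vec m) (x : ℝ → Vec n), 0 < T → x₀ ∈ S.G →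
    S.IsControl u → S.IsTrajectory T x₀ u x → ∀ t, 0 ≤ t → ENNReal.ofReal t < T → x t ∈ S.G
  lipschitz_f : ∀ R : ℝ, 0 < R → ∃ C : ℝ, 0 < C ∧
    ∀ x ∈ Metric.closedBall (0 : Vec n) R ∩ closure S.G,
    ∀ x' ∈ Metric.closedBall (0 : Vec n) R ∩ closure S.G,
    ∀ u ∈ S.U, ‖S.f x u - S.f x' u‖ ≤ C * ‖x - x'‖
  /-- a proper continuously differentiable function growing at most exponentially -/
  growth : ∃ (Y : Vec n → ℝ) (C : ℝ), 0 < C ∧ ContDiffOn ℝ 1 Y S.G₁ ∧ (∀ x ∈ S.G₁, 0 ≤ Y x) ∧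
    (∀ M : Set ℝ, IsCompact M → IsCompact (S.G₁ ∩ Y ⁻¹' M)) ∧
    ∀ x ∈ S.G₁, ∀ u ∈ S.U, fderiv ℝ Y x (S.f x u) ≤ C * Y x

/-- Class `𝒦` (the values off `[0, ∞)` are irrelevant). -/
structure ClassK (φ : ℝ → ℝ) : Prop where
  continuousOn : ContinuousOn φ (Ici 0)
  strictMonoOn : StrictMonoOn φ (Ici 0)
  map_zero : φ 0 = 0

/-- Class `𝒦_∞`. -/
structure ClassKInf (φ : ℝ → ℝ) : Prop extends ClassK φ where
  tendsto : Tendsto φ atTop atTop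

/-- Class `ℒ`. -/
structure ClassL (φ : ℝ → ℝ) : Prop where
  nonneg : ∀ t, 0 ≤ t → 0 ≤ φ t
  continuousOn : ContinuousOn φ (Ici 0)
  antitoneOn : AntitoneOn φ (Ici 0)
  tendsto : Tendsto φ atTop (𝓝 0)

/-- Class `𝒦ℒ`. -/
structure ClassKL (β : ℝ → ℝ → ℝ) : Prop where
  continuousOn : ContinuousOn (fun p : ℝ × ℝ => β p.1 p.2) (Ici 0 ×ˢ Ici 0)
  classK : ∀ t, 0 ≤ t → ClassK fun ρ => β ρ t
  classL : ∀ ρ, 0 ≤ ρ → ClassL fun t => β ρ t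

/-- Local asymptotic null-controllability, with controls bounded by `ubar`. -/
def Data.LocallyControllable (S : Data n m) (r ubar : ℝ) (β : ℝ → ℝ → ℝ) : Prop :=
  ∀ x₀ ∈ Metric.ball (0 : Vec n) r, ∃ (u : ℝ → Vec m) (x : ℝ → Vec n),
    S.IsControl u ∧ S.IsTrajectory ∞ x₀ u x ∧
    (∀ᵐ t ∂(volume.restrict (Ici (0 : ℝ))), ‖u t‖ ≤ ubar) ∧
    ∀ t, 0 ≤ t → ‖x t‖ ≤ β ‖x₀‖ t

/-- The small control property. -/
def Data.SmallControl (S : Data n m) (r : ℝ) (β : ℝ → ℝ → ℝ) : Prop :=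
  ∀ x₀ ∈ Metric.ball (0 : Vec n) r, ∃ (u : ℝ → Vec m) (x : ℝ → Vec n),
    S.IsControl u ∧ S.IsTrajectory ∞ x₀ u x ∧
    ∀ᵐ t ∂(volume.restrict (Ici (0 : ℝ))), ‖x t‖ + ‖u t‖ ≤ β ‖x₀‖ t

/-- The inverse of a class `𝒦_∞` function, on `[0, ∞)`. -/
noncomputable def kInv (α : ℝ → ℝ) : ℝ → ℝ := Function.invFunOn α (Ici 0)

/-- Bound of the running cost near the origin that goes with `LocallyControllable`. -/
def Data.CostBound (S : Data n m) (r ubar : ℝ) (α₂ : ℝ → ℝ) : Prop :=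
  ∃ C C' : ℝ, 0 < C ∧ 0 < C' ∧
    ∀ x ∈ Metric.closedBall (0 : Vec n) r, ∀ u ∈ Metric.closedBall (0 : Vec m) ubar ∩ S.U,
      S.g x u ≤ C * (kInv α₂ ‖x‖) ^ C'

/-- Bound of the running cost near the origin that goes with `SmallControl`. -/
def Data.SmallControlCostBound (S : Data n m) (r ubar : ℝ) (α₂ : ℝ → ℝ) : Prop :=
  ∃ C C' : ℝ, 0 < C ∧ 0 < C' ∧
    ∀ x ∈ Metric.closedBall (0 : Vec n) r, ∀ u ∈ Metric.closedBall (0 : Vec m) ubar ∩ S.U,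
      S.g x u ≤ C * (kInv α₂ (‖x‖ + ‖u‖)) ^ C'

/-- The assumptions on the running cost that do not depend on the form of controllability. -/
structure Data.RegularCost (S : Data n m) (r ubar : ℝ) : Prop where
  nonneg : ∀ x ∈ closure S.G, ∀ u ∈ S.U, 0 ≤ S.g x u
  continuous_g : ContinuousOn (fun p : Vec n × Vec m => S.g p.1 p.2) (closure S.G ×ˢ S.U)
  lipschitz_g : ∀ R : ℝ, 0 < R → ∃ C : ℝ, 0 < C ∧
    ∀ x ∈ Metric.closedBall (0 : Vec n) R ∩ closure S.G,
    ∀ x' ∈ Metric.closedBall (0 : Vec n) R ∩ closure S.G,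
    ∀ u ∈ S.U, |S.g x u - S.g x' u| ≤ C * ‖x - x'‖
  /-- positive infimum off every ball around the origin -/
  inf_pos : ∀ R : ℝ, 0 < R → ∃ c : ℝ, 0 < c ∧
    ∀ x ∈ closure S.G, ∀ u ∈ S.U, R ≤ ‖x‖ → c ≤ S.g x u
  growth : ∃ C : ℝ, 0 < C ∧ ∀ x ∈ closure S.G, ∀ u ∈ S.U,
    (2 * r ≤ ‖x‖ ∨ 2 * ubar ≤ ‖u‖) → C * ‖S.f x u‖ ≤ S.g x u

/-- The region of asymptotic null-controllability. -/
def Data.D₀ (S : Data n m) : Set (Vec n) :=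
  {x₀ | x₀ ∈ S.G ∧ ∃ (u : ℝ → Vec m) (x : ℝ → Vec n),
    S.IsControl u ∧ S.IsTrajectory ∞ x₀ u x ∧ Tendsto (fun t => ‖x t‖) atTop (𝓝 0)}

/-- The infinite-horizon value function. -/
noncomputable def Data.V₀ (S : Data n m) (x₀ : Vec n) : ℝ≥0∞ :=
  ⨅ (u : ℝ → Vec m) (x : ℝ → Vec n) (_ : S.IsControl u) (_ : S.IsTrajectory ∞ x₀ u x),
    ∫⁻ t in Ici (0 : ℝ), ENNReal.ofReal (S.g (x t) (u t))

/-- The exit-time value function for the target `closedBall 0 δ` and zero terminal cost; it is `∞`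
if the target cannot be reached. -/
noncomputable def Data.V (S : Data n m) (δ : ℝ) (x₀ : Vec n) : ℝ≥0∞ :=
  ⨅ (u : ℝ → Vec m) (x : ℝ → Vec n) (T : ℝ) (_ : S.IsControl u) (_ : S.IsTrajectory ∞ x₀ u x)
    (_ : 0 ≤ T) (_ : x T ∈ Metric.closedBall (0 : Vec n) δ),
    ∫⁻ t in Icc (0 : ℝ) T, ENNReal.ofReal (S.g (x t) (u t))

open Classical in
/-- The Kruzhkov transform `a ↦ 1 - e^{-a}`, with `e^{-∞} = 0`. -/
noncomputable def kruzhkov (a : ℝ≥0∞) : ℝ :=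
  if a = ∞ then 1 else 1 - Real.exp (-a.toReal)

end ExitTime

open ExitTime

namespace ExitTime

/-! Everything about convergence comes from the sandwich `V δ ≤ V₀ ≤ V δ + sup V₀`, the supremum
being over the closed ball of radius `δ`. The left inequality (`V_le_V₀`) holds because `g` is
bounded below away from the origin, so a trajectory of finite total cost must visit every ball. The
right one (`V₀_le_V_add`) is dynamic programming: on reaching the ball, continue almost optimally
for `V₀`. The supremum tends to `0` (`V₀_small`): along the stabilizing trajectories the running
cost is at most `C (α₁ ‖x₀‖ e^{-t})^{C'}`, whose integral over time is a constant times `(α₁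
‖x₀‖)^{C'}`. Hence the values converge uniformly on all of `D₀`, and their transforms on `G`, since
`1 - e^{-a}` is 1-Lipschitz and the two values are infinite together. `D₀` is the domain of
finiteness because a trajectory tending to `0` enters the target in finite time at finite cost,
while every point of the closed `r`-ball lies in `D₀`. For the Lipschitz bound, a nearly optimal
control for `p` is applied from a nearby `q` up to the first hitting time of `p`. That time is
bounded, since `g` is bounded below outside the target, so the trajectories stay within `L ‖p - q‖`
of each other. The Petrov condition makes the remaining gap cost at most `κ` times its length.
Rademacher's theorem then gives differentiability almost everywhere. All this needs a trajectory for
every control and initial point in `G`: Peano's theorem for a truncated system, with the proper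
function `Y` excluding blow-up. -/

/-! ### Grönwall's inequality and Arzelà–Ascoli compactness -/

/-- Grönwall's inequality in integral form. -/
theorem le_mul_exp_of_le_add_integral {φ : ℝ → ℝ} {a C T : ℝ} (hφ : ContinuousOn φ (Icc 0 T))
    (hC : 0 ≤ C) (h0 : ∀ t ∈ Icc 0 T, 0 ≤ φ t)
    (h : ∀ t ∈ Icc 0 T, φ t ≤ a + C * ∫ s in (0 : ℝ)..t, φ s) :
    ∀ t ∈ Icc 0 T, φ t ≤ a * Real.exp (C * t) := by
  intro t ht
  have hT : 0 ≤ T := ht.1.trans ht.2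
  -- Extending `φ` by its end values makes the primitive differentiable everywhere, so that the
  -- differential form of Grönwall applies to `a + C ∫ φ`.
  have hψc : Continuous (IccExtend hT ((Icc 0 T).domRestrict φ)) :=
    (continuousOn_iff_continuous_domRestrict.1 hφ).Icc_extend'
  set ψ := IccExtend hT ((Icc 0 T).domRestrict φ) with hψ
  have hψφ : ∀ s ∈ Icc 0 T, ψ s = φ s := fun s hs => by
    rw [hψ, IccExtend_of_mem hT _ hs]; rfl
  have hint : ∀ s ∈ Icc 0 T, ∫ τ in (0 : ℝ)..s, φ τ = ∫ τ in (0 : ℝ)..s, ψ τ := fun s hs => by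
    refine intervalIntegral.integral_congr fun τ hτ => (hψφ τ ?_).symm
    rw [uIcc_of_le hs.1] at hτ
    exact ⟨hτ.1, hτ.2.trans hs.2⟩
  have hd : ∀ s, HasDerivAt (fun s => a + C * ∫ τ in (0 : ℝ)..s, ψ τ) (C * ψ s) s := fun s =>
    ((hψc.integral_hasStrictDerivAt 0 s).hasDerivAt.const_mul C).const_add a
  have ha : ‖a + C * ∫ τ in (0 : ℝ)..0, ψ τ‖ ≤ a := by
    have h1 := h 0 ⟨le_rfl, hT⟩
    have h2 := h0 0 ⟨le_rfl, hT⟩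
    simp only [intervalIntegral.integral_same, mul_zero, add_zero] at h1 ⊢
    rw [Real.norm_of_nonneg (h2.trans h1)]
  have key := norm_le_gronwallBound_of_norm_deriv_right_le (a := 0) (b := T) (K := C) (ε := 0)
    (fun s _ => (hd s).continuousAt.continuousWithinAt) (fun s _ => (hd s).hasDerivWithinAt) ha
    (fun s hs => by
      have hs' : s ∈ Icc 0 T := ⟨hs.1, hs.2.le⟩
      have h1 := h s hs'
      rw [hint s hs'] at h1
      rw [add_zero, hψφ s hs', norm_mul, Real.norm_of_nonneg hC, Real.norm_of_nonneg (h0 s hs')]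
      exact mul_le_mul_of_nonneg_left (h1.trans (Real.le_norm_self _)) hC) t ht
  rw [gronwallBound_ε0, sub_zero] at key
  have h1 := h t ht
  rw [hint t ht] at h1
  exact h1.trans ((Real.le_norm_self _).trans key)

/-- Arzelà–Ascoli: the Lipschitz condition with a fixed constant is closed under pointwise limits,
and the common initial value puts each `w t` in a fixed ball, so Tychonoff gives pointwise
compactness. -/
theorem exists_subseq_tendsto_of_lipschitzWith {E : Type*} [NormedAddCommGroup E]
    [ProperSpace E] {M : NNReal} {T : ℝ} {x₀ : E}
    {z : ℕ → ℝ → E} (hz : ∀ k, LipschitzWith M (z k)) (hz0 : ∀ k, z k 0 = x₀) :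
    ∃ (x : ℝ → E) (φ : ℕ → ℕ), Continuous x ∧ StrictMono φ ∧
      ∀ t ∈ Icc 0 T, Tendsto (fun k => z (φ k) t) atTop (𝓝 (x t)) := by
  rcases lt_or_ge T 0 with hT | hT
  · exact ⟨fun _ => x₀, id, continuous_const, strictMono_id,
      fun t ht => absurd (ht.1.trans ht.2) (not_le.2 hT)⟩
  let X := Icc (0 : ℝ) T
  let p₀ : X := ⟨0, le_rfl, hT⟩
  let S : Set C(X, E) := {w | LipschitzWith M w ∧ w p₀ = x₀}
  have hS : IsCompact S := by
    refine ArzelaAscoli.isCompact_of_equicontinuous S ?_ ?_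
    · have himg : (ContinuousMap.toFun '' S : Set (X → E)) =
          {w : X → E | LipschitzWith M w ∧ w p₀ = x₀} := by
        ext w
        constructor
        · rintro ⟨w, hw, rfl⟩; exact hw
        · intro hw; exact ⟨⟨w, hw.1.continuous⟩, hw, rfl⟩
      rw [himg]
      refine (isCompact_univ_pi fun t : X => isCompact_closedBall x₀ (M * dist t p₀)).of_isClosed_subset
        ?_ ?_
      · have h1 : IsClosed {w : X → E | ∀ s t, dist (w s) (w t) ≤ M * dist s t} := by
          simp only [ofPred_forall]
          exact isClosed_iInter fun s => isClosed_iInter fun t =>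
            isClosed_le ((continuous_apply s).dist (continuous_apply t)) continuous_const
        have h2 : IsClosed {w : X → E | w p₀ = x₀} :=
          isClosed_eq (continuous_apply p₀) continuous_const
        simp only [lipschitzWith_iff_dist_le_mul]
        exact h1.inter h2
      · rintro w ⟨hw, hw0⟩ t -
        rw [Metric.mem_closedBall, ← hw0]
        exact hw.dist_le_mul t p₀
    · exact LipschitzWith.uniformEquicontinuous _ M (fun w => w.2.1) |>.equicontinuous
  obtain ⟨w, -, φ, hφ, hw⟩ := hS.tendsto_subseq
    (x := fun k => (⟨fun t : X => z k t, (hz k).continuous.comp continuous_subtype_val⟩ : C(X, E)))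
    (fun k => ⟨(hz k).comp (LipschitzWith.subtype_val _) |>.weaken (by simp), hz0 k⟩)
  refine ⟨IccExtend hT w, φ, w.continuous.Icc_extend', hφ, fun t ht => ?_⟩
  rw [IccExtend_of_mem hT _ ht]
  exact ((continuous_eval_const (⟨t, ht⟩ : X)).tendsto w).comp hw

/-! ### Peano's theorem by Tonelli's delay scheme -/

section Peano

variable {E : Type*} [NormedAddCommGroup E] [NormedSpace ℝ E]

/-- The `max t 0` freezes the function at `x₀` for negative times, where the delayed argument `s -
h` may fall. -/
theorem lipschitzWith_primitive {v : ℝ → E} {M : NNReal}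
    (hv : AEStronglyMeasurable v volume) (hM : ∀ s, ‖v s‖ ≤ M) (x₀ : E) :
    LipschitzWith M fun t => x₀ + ∫ s in (0 : ℝ)..(max t 0), v s := by
  have hi : ∀ a b, IntervalIntegrable v volume a b := fun a b => by
    refine (intervalIntegrable_const (c := (M : ℝ))).mono_fun hv.restrict ?_
    exact Eventually.of_forall fun s => (hM s).trans (Real.le_norm_self _)
  refine LipschitzWith.of_dist_le_mul fun s t => ?_
  rw [dist_eq_norm, add_sub_add_left_eq_sub, intervalIntegral.integral_interval_sub_left (hi _ _) (hi _ _)]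
  refine (intervalIntegral.norm_integral_le_of_norm_le_const fun τ _ => hM τ).trans ?_
  gcongr
  rw [Real.dist_eq]
  exact abs_max_sub_max_le_abs s t 0

/-- Approximate solutions with delay `h` (Tonelli's scheme). -/
theorem exists_delayed_solution {F : ℝ → E → E} {M : NNReal} (hM : ∀ s x, ‖F s x‖ ≤ M)
    (hm : ∀ y : ℝ → E, Continuous y → AEStronglyMeasurable (fun s => F s (y s)) volume)
    (x₀ : E) (T : ℝ) {h : ℝ} (hh : 0 < h) :
    ∃ z : ℝ → E, LipschitzWith M z ∧ z 0 = x₀ ∧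
      ∀ t ∈ Icc 0 T, z t = x₀ + ∫ s in (0 : ℝ)..t, F s (z (s - h)) := by
  let Φ : (ℝ → E) → ℝ → E := fun y t => x₀ + ∫ s in (0 : ℝ)..(max t 0), F s (y (s - h))
  let Y : ℕ → ℝ → E := fun N => Φ^[N] fun _ => x₀
  have hY : ∀ N, Y (N + 1) = Φ (Y N) := fun N => Function.iterate_succ_apply' _ _ _
  have hlip : ∀ N, LipschitzWith M (Y N) := by
    intro N
    induction N with
    | zero => exact (LipschitzWith.const x₀).weaken zero_le
    | succ N ih =>
      rw [hY]
      exact lipschitzWith_primitive (hm _ (ih.continuous.comp (by fun_prop))) (fun s => hM _ _) x₀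
  -- Because of the delay, the values of `Φ y` up to `(N + 1) h` depend only on those of `y` up to
  -- `N h`. The iterates therefore stabilize on `[0, T]` after finitely many steps.
  have hagree : ∀ N : ℕ, ∀ t ≤ N * h, Y (N + 1) t = Y N t := by
    intro N
    induction N with
    | zero =>
      intro t ht
      have : max t 0 = 0 := max_eq_right (by simpa using ht)
      simp [Y, Φ, this]
    | succ N ih =>
      intro t ht
      rw [hY (N + 1)]
      conv_rhs => rw [hY N]
      simp only [Φ]
      congr 1
      refine intervalIntegral.integral_congr fun s hs => ?_
      rw [uIcc_of_le (le_max_right _ _)] at hs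
      rw [ih]
      have : s ≤ (N + 1) * h := hs.2.trans (max_le (by exact_mod_cast ht) (by positivity))
      linarith
  obtain ⟨N, hN⟩ := exists_nat_ge (T / h)
  have hN' : T ≤ N * h := (div_le_iff₀ hh).1 hN
  refine ⟨Y N, hlip N, ?_, fun t ht => ?_⟩
  · rw [← hagree N 0 (by positivity), hY]
    simp [Φ]
  · rw [← hagree N t (ht.2.trans hN'), hY]
    simp only [Φ, max_eq_left ht.1]

/-- Peano's existence theorem for bounded Carathéodory right-hand sides. -/
theorem exists_solution_of_bounded [ProperSpace E] {F : ℝ → E → E} {M : NNReal}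
    (hM : ∀ s x, ‖F s x‖ ≤ M) (hc : ∀ s, Continuous (F s))
    (hm : ∀ y : ℝ → E, Continuous y → AEStronglyMeasurable (fun s => F s (y s)) volume)
    (x₀ : E) (T : ℝ) :
    ∃ x : ℝ → E, Continuous x ∧ ∀ t ∈ Icc 0 T, x t = x₀ + ∫ s in (0 : ℝ)..t, F s (x s) := by
  have hpos : ∀ k : ℕ, (0 : ℝ) < 1 / ((k : ℝ) + 1) := fun k => Nat.one_div_pos_of_nat
  choose z hz hz0 hzt using fun k : ℕ => exists_delayed_solution hM hm x₀ T (hpos k)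
  obtain ⟨x, φ, hx, hφ, hlim⟩ := exists_subseq_tendsto_of_lipschitzWith (T := T) hz hz0
  refine ⟨x, hx, fun t ht => ?_⟩
  -- The common Lipschitz constant makes the vanishing delay harmless in the limit.
  have hdelay : ∀ s ∈ Icc 0 T,
      Tendsto (fun k => z (φ k) (s - 1 / (((φ k : ℕ) : ℝ) + 1))) atTop (𝓝 (x s)) := by
    intro s hs
    have h1 : Tendsto (fun k => (M : ℝ) * (1 / (((φ k : ℕ) : ℝ) + 1))) atTop (𝓝 0) := by
      simpa using (tendsto_one_div_add_atTop_nhds_zero_nat.comp hφ.tendsto_atTop).const_mul (M : ℝ)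
    refine tendsto_of_tendsto_of_dist (hlim s hs) (squeeze_zero (fun _ => dist_nonneg) (fun k => ?_) h1)
    refine ((hz (φ k)).dist_le_mul _ _).trans ?_
    gcongr
    rw [Real.dist_eq, sub_sub_cancel, abs_of_pos (hpos _)]
  have hint : Tendsto (fun k => ∫ s in (0 : ℝ)..t, F s (z (φ k) (s - 1 / (((φ k : ℕ) : ℝ) + 1))))
      atTop (𝓝 (∫ s in (0 : ℝ)..t, F s (x s))) := by
    refine intervalIntegral.tendsto_integral_filter_of_dominated_convergence (fun _ => (M : ℝ))
      (Eventually.of_forall fun k => ?_) (Eventually.of_forall fun k => ?_)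
      intervalIntegrable_const (Eventually.of_forall fun s hs => ?_)
    · exact (hm _ ((hz (φ k)).continuous.comp (by fun_prop))).restrict
    · exact Eventually.of_forall fun s _ => hM _ _
    · rw [uIoc_of_le ht.1] at hs
      exact ((hc s).tendsto _).comp (hdelay s ⟨hs.1.le, hs.2.trans ht.2⟩)
  refine tendsto_nhds_unique (hlim t ht) ?_
  simp only [fun k => hzt (φ k) t ht]
  exact hint.const_add x₀

end Peano

/-! ### Controls and growth of `Y` along trajectories -/

section

variable {n m : ℕ} {S : Data n m}

/-- Boundedness is automatic from the compactness of `U`; only measurability remains to be checked.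
-/
theorem Data.Regular.isControl_iff (hS : S.Regular) {u : ℝ → Vec m} :
    S.IsControl u ↔
      (∀ t, 0 ≤ t → u t ∈ S.U) ∧ AEStronglyMeasurable u (volume.restrict (Ici (0 : ℝ))) := by
  refine and_congr_right fun hu => ⟨fun h => ?_, fun h T => ?_⟩
  · have : (Ici (0 : ℝ)) = ⋃ k : ℕ, Icc (0 : ℝ) k := by
      ext t
      simp only [mem_Ici, mem_iUnion, mem_Icc]
      exact ⟨fun ht => (exists_nat_ge t).imp fun k hk => ⟨ht, hk⟩, fun ⟨k, hk⟩ => hk.1⟩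
    rw [this, aestronglyMeasurable_iUnion_iff]
    exact fun k => (h k).1
  · obtain ⟨M, hM⟩ := hS.compact_U.isBounded.exists_norm_le
    refine MemLp.of_bound (h.mono_measure (Measure.restrict_mono Icc_subset_Ici_self le_rfl)) M ?_
    exact (ae_restrict_mem measurableSet_Icc).mono fun t ht => hM _ (hu t ht.1)

theorem Data.Regular.isControl_const (hS : S.Regular) {w : Vec m} (hw : w ∈ S.U) :
    S.IsControl fun _ => w :=
  hS.isControl_iff.2 ⟨fun _ _ => hw, aestronglyMeasurable_const⟩

/-- Superposition of a continuous function with a trajectory and a control. -/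
theorem aestronglyMeasurable_comp_control {E : Type*} [NormedAddCommGroup E]
    [SecondCountableTopology E] [MeasurableSpace E] [BorelSpace E]
    (hU : IsCompact S.U) {A : Set (Vec n)} (hA : MeasurableSet A) {h : Vec n → Vec m → E}
    (hh : ContinuousOn (fun p : Vec n × Vec m => h p.1 p.2) (A ×ˢ S.U)) {I : Set ℝ}
    (hI : MeasurableSet I) {x : ℝ → Vec n} (hx : ContinuousOn x I) (hxA : ∀ t ∈ I, x t ∈ A)
    {u : ℝ → Vec m} (hu : AEStronglyMeasurable u (volume.restrict I)) (huU : ∀ t ∈ I, u t ∈ S.U) :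
    AEStronglyMeasurable (fun t => h (x t) (u t)) (volume.restrict I) := by
  classical
  have hAU : MeasurableSet (A ×ˢ S.U) := hA.prod hU.isClosed.measurableSet
  -- Extension by zero off `A ×ˢ S.U` turns `h` into a globally Borel function.
  have hH : Measurable ((A ×ˢ S.U).piecewise (fun p : Vec n × Vec m => h p.1 p.2) fun _ => 0) :=
    hh.measurable_piecewise continuousOn_const hAU
  have hxu : AEMeasurable (fun t => (x t, u t)) (volume.restrict I) :=
    (hx.aemeasurable hI).prodMk hu.aemeasurable
  refine (hH.stronglyMeasurable.aestronglyMeasurable.comp_aemeasurable hxu).congr ?_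
  refine (ae_restrict_mem hI).mono fun t ht => ?_
  exact piecewise_eq_of_mem _ _ _ (mk_mem_prod (hxA t ht) (huU t ht))

/-- Exponential growth of `Y` along solutions of `x' = θ(x) f(x, u)`, `0 ≤ θ ≤ 1`. -/
theorem Data.Regular.growth_along (hS : S.Regular) {Y : Vec n → ℝ} {C : ℝ} (hC : 0 < C)
    (hY : ContDiffOn ℝ 1 Y S.G₁) (hY0 : ∀ x ∈ S.G₁, 0 ≤ Y x)
    (hYf : ∀ x ∈ S.G₁, ∀ u ∈ S.U, fderiv ℝ Y x (S.f x u) ≤ C * Y x)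
    {θ : Vec n → ℝ} (hθ : Continuous θ) (hθ01 : ∀ q, θ q ∈ Icc (0 : ℝ) 1)
    {u : ℝ → Vec m} (hu : ∀ t, 0 ≤ t → u t ∈ S.U) {x : ℝ → Vec n} {x₀ : Vec n} {T : ℝ}
    (hx : ContinuousOn x (Icc 0 T)) (hxG : ∀ t ∈ Icc 0 T, x t ∈ S.G₁)
    (hi : ∀ t ∈ Icc 0 T, IntervalIntegrable (fun s => θ (x s) • S.f (x s) (u s)) volume 0 t)
    (hxt : ∀ t ∈ Icc 0 T, x t = x₀ + ∫ s in (0 : ℝ)..t, θ (x s) • S.f (x s) (u s)) :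
    ∀ t ∈ Icc 0 T, Y (x t) ≤ Y x₀ * Real.exp (C * t) := by
  intro t ht
  have hx0 : x 0 = x₀ := by
    simpa using hxt 0 ⟨le_rfl, ht.1.trans ht.2⟩
  -- A trajectory need not be differentiable at every time, so Grönwall is used in its
  -- Dini-derivative form.
  have key := le_gronwallBound_of_liminf_deriv_right_le (f := fun t => Y (x t))
    (f' := fun t => C * Y (x t)) (δ := Y x₀) (K := C) (ε := 0) (a := 0) (b := T)
    (hY.continuousOn.comp hx hxG) ?_ (by rw [hx0]) (fun _ _ => by simp) t ht
  · rwa [gronwallBound_ε0, sub_zero] at key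
  intro s hs r hr
  have hs' : s ∈ Icc 0 T := ⟨hs.1, hs.2.le⟩
  set p := x s with hp
  have hpG : p ∈ S.G₁ := hxG s hs'
  -- The slack is split in three: one part for the drift near `p`, one for the remainder of `Y` at
  -- `p`, and one for strictness.
  set e := (r - C * Y p) / 3 with he
  have he0 : 0 < e := by rw [he]; linarith
  have hfc : ContinuousOn (fun v => S.f p v) S.U :=
    hS.continuous_f.comp (by fun_prop) fun v hv => mk_mem_prod hpG hv
  obtain ⟨M, hM⟩ := (hS.compact_U.image_of_continuousOn hfc).isBounded.exists_norm_le
  have hM0 : 0 ≤ M := (norm_nonneg _).trans (hM _ (mem_image_of_mem _ (hu s hs.1)))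
  have hcθ : ContinuousOn (fun q : Vec n × Vec m => θ q.1 • S.f q.1 q.2) (S.G₁ ×ˢ S.U) :=
    (hθ.comp continuous_fst).continuousOn.smul hS.continuous_f
  -- The bound must be uniform in `v`, as the control has no continuity at time `s`; compactness of
  -- `U` provides this.
  have hnear : ∀ᶠ q in 𝓝 p, ∀ v ∈ S.U, q ∈ S.G₁ → v ∈ S.U →
      fderiv ℝ Y p (θ q • S.f q v) < C * Y p + e ∧ ‖θ q • S.f q v‖ < M + 1 := by
    refine hS.compact_U.eventually_forall_of_forall_eventually
      (P := fun q v => q ∈ S.G₁ → v ∈ S.U →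
        fderiv ℝ Y p (θ q • S.f q v) < C * Y p + e ∧ ‖θ q • S.f q v‖ < M + 1) fun v hv => ?_
    have hcw := hcθ (p, v) (mk_mem_prod hpG hv)
    have h1 : fderiv ℝ Y p (θ p • S.f p v) < C * Y p + e := by
      rw [map_smul, smul_eq_mul]
      have := hYf p hpG v hv
      have h0 := mul_nonneg hC.le (hY0 p hpG)
      have h3 := hθ01 p
      nlinarith [mul_le_mul_of_nonneg_left this h3.1, mul_le_mul_of_nonneg_right h3.2 h0]
    have h2 : ‖θ p • S.f p v‖ < M + 1 := by
      rw [norm_smul, Real.norm_of_nonneg (hθ01 p).1]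
      have := hM _ (mem_image_of_mem _ hv)
      have h3 := mul_le_mul (hθ01 p).2 this (norm_nonneg _) zero_le_one
      linarith
    have e1 := ((fderiv ℝ Y p).continuous.continuousAt.comp_continuousWithinAt hcw).eventually
      (gt_mem_nhds h1)
    have e2 := hcw.norm.eventually (gt_mem_nhds h2)
    filter_upwards [eventually_nhdsWithin_iff.1 e1, eventually_nhdsWithin_iff.1 e2] with z hz1 hz2 ha hb
    exact ⟨hz1 ⟨ha, hb⟩, hz2 ⟨ha, hb⟩⟩
  have hdiff : HasFDerivAt Y (fderiv ℝ Y p) p :=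
    ((hY.differentiableOn (by norm_num)).differentiableAt (hS.open_G₁.mem_nhds hpG)).hasFDerivAt
  have hlin := hdiff.isLittleO.def (c := e / (M + 1)) (by positivity)
  have hxs : Tendsto x (𝓝[≥] s) (𝓝 p) :=
    ((hx s hs').mono_of_mem_nhdsWithin (Icc_mem_nhdsGE_of_mem hs)).tendsto
  have hev := (hxs.eventually (hnear.and hlin)).and (Ico_mem_nhdsGE hs.2)
  obtain ⟨b, hb, hsub⟩ := mem_nhdsGE_iff_exists_Ico_subset.1 hev
  refine Eventually.frequently ?_
  filter_upwards [Ioo_mem_nhdsGT hb] with z hz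
  have hzpos : 0 < z - s := sub_pos.2 hz.1
  have hzT : z ∈ Icc 0 T := ⟨hs.1.trans hz.1.le, (hsub ⟨hz.1.le, hz.2⟩).2.2.le⟩
  have hii : IntervalIntegrable (fun s => θ (x s) • S.f (x s) (u s)) volume s z :=
    (hi s hs').symm.trans (hi z hzT)
  have hxz : x z - p = ∫ σ in s..z, θ (x σ) • S.f (x σ) (u σ) := by
    rw [hp, hxt z hzT, hxt s hs', add_sub_add_left_eq_sub,
      intervalIntegral.integral_interval_sub_left (hi z hzT) (hi s hs')]
  have hσ : ∀ σ ∈ Icc s z, fderiv ℝ Y p (θ (x σ) • S.f (x σ) (u σ)) ≤ C * Y p + e ∧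
      ‖θ (x σ) • S.f (x σ) (u σ)‖ ≤ M + 1 := fun σ hσ => by
    have h1 := (hsub ⟨hσ.1, hσ.2.trans_lt hz.2⟩).1.1
    have h0 := hs.1.trans hσ.1
    have h2 := h1 (u σ) (hu σ h0) (hxG σ ⟨h0, hσ.2.trans hzT.2⟩) (hu σ h0)
    exact ⟨h2.1.le, h2.2.le⟩
  have hnorm : ‖x z - p‖ ≤ (M + 1) * (z - s) := by
    rw [hxz]
    refine (intervalIntegral.norm_integral_le_of_norm_le_const (C := M + 1) fun σ h => ?_).trans ?_
    · rw [uIoc_of_le hz.1.le] at h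
      exact (hσ σ ⟨h.1.le, h.2⟩).2
    · rw [abs_of_pos hzpos]
  have hD : fderiv ℝ Y p (x z - p) ≤ (C * Y p + e) * (z - s) := by
    rw [hxz, ← (fderiv ℝ Y p).intervalIntegral_comp_comm hii]
    refine (intervalIntegral.integral_mono_on hz.1.le ?_ intervalIntegrable_const
      fun σ h => (hσ σ h).1).trans ?_
    · exact ⟨(fderiv ℝ Y p).integrable_comp hii.1, (fderiv ℝ Y p).integrable_comp hii.2⟩
    · rw [intervalIntegral.integral_const, smul_eq_mul, mul_comm]
  have hrem : Y (x z) - Y p - fderiv ℝ Y p (x z - p) ≤ e * (z - s) := by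
    refine (Real.le_norm_self _).trans ((hsub ⟨hz.1.le, hz.2⟩).1.2.trans ?_)
    rw [div_mul_eq_mul_div, div_le_iff₀ (by positivity), mul_assoc, mul_comm (z - s)]
    exact mul_le_mul_of_nonneg_left hnorm he0.le
  rw [inv_mul_lt_iff₀ hzpos]
  have : r = C * Y p + 3 * e := by rw [he]; ring
  rw [this]
  nlinarith [mul_pos he0 hzpos]

/-! ### Dependence on the initial value -/

namespace Data.IsTrajectory

variable {τ : ℝ≥0∞} {x₀ y₀ : Vec n} {u : ℝ → Vec m} {x y : ℝ → Vec n}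

theorem map_zero (hx : S.IsTrajectory ∞ x₀ u x) : x 0 = x₀ := by
  simpa using (hx.2 0 le_rfl (by simp)).2.2

theorem mem_G (hx : S.IsTrajectory ∞ x₀ u x) (hS : S.Regular) (hx₀ : x₀ ∈ S.G)
    (hu : S.IsControl u) {t : ℝ} (ht : 0 ≤ t) : x t ∈ S.G :=
  hS.invariant ∞ x₀ u x (by simp) hx₀ hu hx t ht (by simp)

theorem continuousOn_Ici (hx : S.IsTrajectory ∞ x₀ u x) : ContinuousOn x (Ici 0) :=
  hx.1.mono fun t ht => ⟨ht, by simp⟩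

theorem dist_le (hx : S.IsTrajectory τ x₀ u x) (hy : S.IsTrajectory τ y₀ u y)
    (hu : S.IsControl u) {A : Set (Vec n)} {C : ℝ} (hC : 0 ≤ C)
    (hA : ∀ p ∈ A, ∀ q ∈ A, ∀ v ∈ S.U, ‖S.f p v - S.f q v‖ ≤ C * ‖p - q‖)
    {T : ℝ} (hT : ENNReal.ofReal T < τ)
    (hxA : ∀ t ∈ Icc 0 T, x t ∈ A) (hyA : ∀ t ∈ Icc 0 T, y t ∈ A) :
    ∀ t ∈ Icc 0 T, ‖x t - y t‖ ≤ ‖x₀ - y₀‖ * Real.exp (C * t) := by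
  have hlt : ∀ t ∈ Icc 0 T, ENNReal.ofReal t < τ := fun t ht =>
    (ENNReal.ofReal_le_ofReal ht.2).trans_lt hT
  have hxc : ContinuousOn x (Icc 0 T) := hx.1.mono fun t ht => ⟨ht.1, hlt t ht⟩
  have hyc : ContinuousOn y (Icc 0 T) := hy.1.mono fun t ht => ⟨ht.1, hlt t ht⟩
  refine le_mul_exp_of_le_add_integral (hxc.sub hyc).norm hC (fun _ _ => norm_nonneg _)
    fun t ht => ?_
  obtain ⟨-, hxi, hxt⟩ := hx.2 t ht.1 (hlt t ht)
  obtain ⟨-, hyi, hyt⟩ := hy.2 t ht.1 (hlt t ht)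
  have heq : x t - y t = (x₀ - y₀) + ∫ s in (0 : ℝ)..t, (S.f (x s) (u s) - S.f (y s) (u s)) := by
    rw [intervalIntegral.integral_sub hxi hyi, hxt, hyt]; abel
  rw [heq, ← intervalIntegral.integral_const_mul]
  refine (norm_add_le _ _).trans (add_le_add_right ?_ _)
  refine intervalIntegral.norm_integral_le_of_norm_le ht.1 (Eventually.of_forall fun s hs => ?_) ?_
  · have hs' : s ∈ Icc 0 T := ⟨hs.1.le, hs.2.trans ht.2⟩
    exact hA _ (hxA s hs') _ (hyA s hs') _ (hu.1 s hs.1.le)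
  · refine ContinuousOn.intervalIntegrable ?_
    rw [uIcc_of_le ht.1]
    exact ((hxc.sub hyc).norm.const_mul C).mono (Icc_subset_Icc_right ht.2)

end Data.IsTrajectory

/-- Trajectories starting in a compact set stay in a compact set, on bounded time intervals. -/
theorem Data.Regular.exists_isCompact_mem (hS : S.Regular) {K₀ : Set (Vec n)} (hK₀ : IsCompact K₀)
    (hK₀G : K₀ ⊆ S.G) (T : ℝ) :
    ∃ K, IsCompact K ∧ K ⊆ closure S.G ∧ ∀ (τ : ℝ≥0∞) (x₀ : Vec n) (u : ℝ → Vec m)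
      (x : ℝ → Vec n), x₀ ∈ K₀ → S.IsControl u → S.IsTrajectory τ x₀ u x →
      ∀ t ∈ Icc 0 T, ENNReal.ofReal t < τ → x t ∈ K := by
  obtain ⟨Y, C, hC, hY, hY0, hYK, hYf⟩ := hS.growth
  have hK₁ : K₀ ⊆ S.G₁ := fun x hx => hS.closure_subset (subset_closure (hK₀G hx))
  obtain ⟨M, hM⟩ := (hK₀.image_of_continuousOn (hY.continuousOn.mono hK₁)).isBounded.exists_norm_le
  refine ⟨closure S.G ∩ (S.G₁ ∩ Y ⁻¹' Icc 0 (M * Real.exp (C * T))),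
    (hYK _ isCompact_Icc).inter_left isClosed_closure, inter_subset_left, ?_⟩
  intro τ x₀ u x hx₀ hu hx t ht htτ
  have hlt : ∀ s ∈ Icc 0 t, ENNReal.ofReal s < τ := fun s hs =>
    (ENNReal.ofReal_le_ofReal hs.2).trans_lt htτ
  have htG : x t ∈ S.G := hS.invariant τ x₀ u x (bot_le.trans_lt htτ) (hK₀G hx₀) hu hx t ht.1 htτ
  have hg := hS.growth_along hC hY hY0 hYf (θ := fun _ => 1) continuous_const
    (fun _ => ⟨zero_le_one, le_rfl⟩) hu.1 (x := x) (x₀ := x₀) (T := t)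
    (hx.1.mono fun s hs => ⟨hs.1, hlt s hs⟩) (fun s hs => (hx.2 s hs.1 (hlt s hs)).1)
    (fun s hs => by simpa using (hx.2 s hs.1 (hlt s hs)).2.1)
    (fun s hs => by simpa using (hx.2 s hs.1 (hlt s hs)).2.2) t ⟨ht.1, le_rfl⟩
  have h1 : x t ∈ S.G₁ := (hx.2 t ht.1 htτ).1
  refine ⟨subset_closure htG, h1, hY0 _ h1, hg.trans ?_⟩
  have h2 : Y x₀ ≤ M := (Real.le_norm_self _).trans (hM _ (mem_image_of_mem _ hx₀))
  have h3 : 0 ≤ M := (hY0 _ (hK₁ hx₀)).trans h2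
  exact mul_le_mul h2 (Real.exp_le_exp.2 (mul_le_mul_of_nonneg_left ht.2 hC.le))
    (Real.exp_pos _).le h3

theorem Data.Regular.lipschitz_on_compact (hS : S.Regular) {K : Set (Vec n)} (hK : IsCompact K)
    (hKG : K ⊆ closure S.G) :
    ∃ C : ℝ, 0 < C ∧ ∀ p ∈ K, ∀ q ∈ K, ∀ v ∈ S.U, ‖S.f p v - S.f q v‖ ≤ C * ‖p - q‖ := by
  obtain ⟨R, hR, hKR⟩ := hK.isBounded.subset_closedBall_lt 0 0
  obtain ⟨C, hC, h⟩ := hS.lipschitz_f R hR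
  exact ⟨C, hC, fun p hp q hq => h p ⟨hKR hp, hKG hp⟩ q ⟨hKR hq, hKG hq⟩⟩

/-- Lipschitz dependence on the initial value. -/
theorem Data.Regular.exists_lipschitz_dependence (hS : S.Regular) {K₀ : Set (Vec n)}
    (hK₀ : IsCompact K₀) (hK₀G : K₀ ⊆ S.G) (T : ℝ) :
    ∃ K, IsCompact K ∧ K ⊆ closure S.G ∧ ∃ L : ℝ, 0 < L ∧
      ∀ (τ : ℝ≥0∞) (x₀ y₀ : Vec n) (u : ℝ → Vec m)
      (x y : ℝ → Vec n), x₀ ∈ K₀ → y₀ ∈ K₀ → S.IsControl u → S.IsTrajectory τ x₀ u x →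
      S.IsTrajectory τ y₀ u y → ∀ t ∈ Icc 0 T, ENNReal.ofReal t < τ →
        x t ∈ K ∧ y t ∈ K ∧ ‖x t - y t‖ ≤ L * ‖x₀ - y₀‖ := by
  obtain ⟨K, hK, hKG, h⟩ := hS.exists_isCompact_mem hK₀ hK₀G T
  obtain ⟨C, hC, hCK⟩ := hS.lipschitz_on_compact hK hKG
  refine ⟨K, hK, hKG, Real.exp (C * T), Real.exp_pos _, ?_⟩
  intro τ x₀ y₀ u x y hx₀ hy₀ hu hx hy t ht htτ
  have hlt : ∀ s ∈ Icc 0 t, ENNReal.ofReal s < τ := fun s hs =>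
    (ENNReal.ofReal_le_ofReal hs.2).trans_lt htτ
  refine ⟨h τ x₀ u x hx₀ hu hx t ht htτ, h τ y₀ u y hy₀ hu hy t ht htτ, ?_⟩
  refine (hx.dist_le hy hu hC.le hCK htτ
    (fun s hs => h τ x₀ u x hx₀ hu hx s ⟨hs.1, hs.2.trans ht.2⟩ (hlt s hs))
    (fun s hs => h τ y₀ u y hy₀ hu hy s ⟨hs.1, hs.2.trans ht.2⟩ (hlt s hs)) t ⟨ht.1, le_rfl⟩).trans ?_
  rw [mul_comm]
  gcongr
  exact ht.2

/-! ### Existence of trajectories -/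

theorem exists_continuous_cutoff {K G : Set (Vec n)} (hK : IsCompact K) (hG : IsOpen G)
    (hKG : K ⊆ G) :
    ∃ (χ : Vec n → ℝ) (K' : Set (Vec n)), Continuous χ ∧ (∀ q, χ q ∈ Icc (0 : ℝ) 1) ∧
      (∀ q ∈ K, χ q = 1) ∧ IsCompact K' ∧ K' ⊆ G ∧ ∀ q ∉ K', χ q = 0 := by
  obtain ⟨K', hK', hKK', hK'G⟩ := exists_compact_between hK hG hKG
  obtain ⟨χ, h1, h0, -, h01⟩ := exists_continuous_one_zero_of_isCompact hK
    isOpen_interior.isClosed_compl (disjoint_compl_right_iff_subset.2 hKK')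
  exact ⟨χ, K', χ.continuous, h01, fun q hq => h1 hq, hK', hK'G,
    fun q hq => h0 fun h => hq (interior_subset h)⟩

/-- Existence of trajectories on bounded time intervals. -/
theorem Data.Regular.exists_trajectory_ofReal (hS : S.Regular) {x₀ : Vec n} (hx₀ : x₀ ∈ S.G)
    {u : ℝ → Vec m} (hu : S.IsControl u) (T : ℝ) :
    ∃ x, S.IsTrajectory (ENNReal.ofReal T) x₀ u x := by
  classical
  obtain ⟨Y, C, hC, hY, hY0, hYK, hYf⟩ := hS.growth
  have hx₁ : x₀ ∈ S.G₁ := hS.closure_subset (subset_closure hx₀)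
  -- By the growth of `Y`, a path cannot leave this set before time `T`. The cutoff equals `1`
  -- there, so a truncated solution solves the original equation.
  set K := S.G₁ ∩ Y ⁻¹' Icc 0 (Y x₀ * Real.exp (C * T)) with hKdef
  have hK : IsCompact K := hYK _ isCompact_Icc
  obtain ⟨χ, K', hχ, hχ01, hχ1, hK', hK'G, hχ0⟩ :=
    exists_continuous_cutoff hK hS.open_G₁ inter_subset_left
  obtain ⟨M, hM⟩ := ((hK'.prod hS.compact_U).image_of_continuousOn
    (hS.continuous_f.mono (prod_mono hK'G Subset.rfl))).isBounded.exists_norm_le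
  have hbound : ∀ q, ∀ v ∈ S.U, ‖χ q • S.f q v‖ ≤ M.toNNReal := by
    intro q v hv
    by_cases hq : q ∈ K'
    · have h1 := hM _ (mem_image_of_mem _ (mk_mem_prod hq hv))
      rw [norm_smul, Real.norm_of_nonneg (hχ01 q).1]
      refine le_trans ?_ (Real.le_coe_toNNReal M)
      have h3 := mul_le_mul (hχ01 q).2 h1 (norm_nonneg _) zero_le_one
      linarith
    · rw [hχ0 q hq, zero_smul, norm_zero]
      exact NNReal.coe_nonneg _
  have hcont : ContinuousOn (fun p : Vec n × Vec m => χ p.1 • S.f p.1 p.2) (univ ×ˢ S.U) := by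
    rintro ⟨q, v⟩ ⟨-, hv⟩
    by_cases hq : q ∈ K'
    · have h1 : ContinuousWithinAt (fun p : Vec n × Vec m => S.f p.1 p.2) (univ ×ˢ S.U) (q, v) :=
        (hS.continuous_f (q, v) ⟨hK'G hq, hv⟩).mono_of_mem_nhdsWithin <| by
          refine mem_nhdsWithin.2 ⟨S.G₁ ×ˢ univ, hS.open_G₁.prod isOpen_univ,
            ⟨hK'G hq, mem_univ _⟩, fun p hp => ⟨hp.1.1, hp.2.2⟩⟩
      exact (hχ.comp continuous_fst).continuousWithinAt.smul h1
    · have h0 : (fun p : Vec n × Vec m => χ p.1 • S.f p.1 p.2) =ᶠ[𝓝 (q, v)] fun _ => 0 := by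
        have : K'ᶜ ×ˢ (univ : Set (Vec m)) ∈ 𝓝 (q, v) :=
          (hK'.isClosed.isOpen_compl.prod isOpen_univ).mem_nhds ⟨hq, mem_univ _⟩
        filter_upwards [this] with p hp
        rw [hχ0 _ hp.1, zero_smul]
      exact (continuousAt_const.congr h0.symm).continuousWithinAt
  -- The control is extended to negative times by a value in `U`, as Peano's theorem above needs a
  -- right-hand side on the whole line.
  set w : ℝ → Vec m := (Ici (0 : ℝ)).piecewise u fun _ => u 0 with hw
  have hwu : ∀ t, 0 ≤ t → w t = u t := fun t ht => piecewise_eq_of_mem _ _ _ ht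
  have hwU : ∀ t, w t ∈ S.U := fun t => by
    by_cases ht : 0 ≤ t
    · rw [hwu t ht]; exact hu.1 t ht
    · rw [hw, piecewise_eq_of_notMem _ _ _ (by simpa using ht)]; exact hu.1 0 le_rfl
  have hwm : AEStronglyMeasurable w volume :=
    AEStronglyMeasurable.piecewise measurableSet_Ici (hS.isControl_iff.1 hu).2
      aestronglyMeasurable_const
  have hmeas : ∀ y : ℝ → Vec n, Continuous y →
      AEStronglyMeasurable (fun s => χ (y s) • S.f (y s) (w s)) volume := by
    intro y hy
    rw [← Measure.restrict_univ (μ := (volume : Measure ℝ))]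
    exact aestronglyMeasurable_comp_control (h := fun q v => χ q • S.f q v) hS.compact_U
      MeasurableSet.univ hcont MeasurableSet.univ hy.continuousOn (fun _ _ => mem_univ _)
      hwm.restrict fun t _ => hwU t
  obtain ⟨x, hx, hxt⟩ := exists_solution_of_bounded (F := fun s q => χ q • S.f q (w s))
    (fun s q => hbound q _ (hwU s))
    (fun s => continuousOn_univ.1 <| hcont.comp (f := fun q => (q, w s)) (by fun_prop)
      fun q _ => ⟨mem_univ _, hwU s⟩) hmeas x₀ T
  have hint : ∀ t, IntervalIntegrable (fun s => χ (x s) • S.f (x s) (w s)) volume 0 t := fun t =>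
    (intervalIntegrable_const (c := (M.toNNReal : ℝ))).mono_fun (hmeas x hx).restrict
      (Eventually.of_forall fun s => (hbound _ _ (hwU s)).trans (Real.le_norm_self _))
  have hin : ∀ t ∈ Icc 0 T, (∀ s ∈ Icc 0 t, x s ∈ S.G₁) → x t ∈ K := by
    intro t ht hs
    have h1 := hS.growth_along hC hY hY0 hYf hχ hχ01 (fun t _ => hwU t) hx.continuousOn hs
      (fun s _ => hint s) (fun s h => hxt s ⟨h.1, h.2.trans ht.2⟩) t ⟨ht.1, le_rfl⟩
    have h2 := hs t ⟨ht.1, le_rfl⟩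
    refine ⟨h2, hY0 _ h2, h1.trans ?_⟩
    have := hY0 _ hx₁
    gcongr
    exact ht.2
  -- At a first exit time from `G₁` the path would be a limit of points of the compact `K ⊆ G₁`,
  -- hence still in `G₁`.
  have hxG : ∀ t ∈ Icc 0 T, x t ∈ S.G₁ := by
    by_contra! hcon
    obtain ⟨t₁, ht₁, ht₁'⟩ := hcon
    have hcl : IsClosed (x ⁻¹' S.G₁ᶜ) := hS.open_G₁.isClosed_compl.preimage hx
    obtain ⟨s, ⟨hsI, hsG⟩, hmin⟩ :=
      (isCompact_Icc.inter_right hcl).exists_isLeast (⟨t₁, ht₁, ht₁'⟩ : (Icc 0 T ∩ x ⁻¹' S.G₁ᶜ).Nonempty)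
    have hx00 : x 0 = x₀ := by simpa using hxt 0 ⟨le_rfl, ht₁.1.trans ht₁.2⟩
    have hs0 : 0 < s := lt_of_le_of_ne hsI.1 fun h => hsG (by rw [← h, hx00]; exact hx₁)
    have hbefore : ∀ σ ∈ Ico 0 s, x σ ∈ K := fun σ hσ =>
      hin σ ⟨hσ.1, hσ.2.le.trans hsI.2⟩ fun ρ hρ => by
        by_contra hcon
        exact absurd (hmin ⟨⟨hρ.1, (hρ.2.trans hσ.2.le).trans hsI.2⟩, hcon⟩)
          (not_le.2 (hρ.2.trans_lt hσ.2))
    have hmem : x s ∈ K := by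
      refine hK.isClosed.mem_of_tendsto (hx.continuousWithinAt (s := Iio s) (x := s)).tendsto ?_
      filter_upwards [Ico_mem_nhdsLT hs0] with σ hσ using hbefore σ hσ
    exact hsG hmem.1
  refine ⟨x, hx.continuousOn, fun t ht htT => ?_⟩
  have ht' : t ∈ Icc 0 T := ⟨ht, (ENNReal.ofReal_lt_ofReal_iff'.1 htT).1.le⟩
  have hcongr : ∀ s ∈ Icc 0 t, χ (x s) • S.f (x s) (w s) = S.f (x s) (u s) := fun s hs => by
    have hs' : s ∈ Icc 0 T := ⟨hs.1, hs.2.trans ht'.2⟩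
    rw [hχ1 _ (hin s hs' fun σ hσ => hxG σ ⟨hσ.1, hσ.2.trans hs'.2⟩), one_smul, hwu s hs.1]
  refine ⟨hxG t ht', (hint t).congr fun s hs => ?_, ?_⟩
  · rw [uIoc_of_le ht] at hs
    exact hcongr s ⟨hs.1.le, hs.2⟩
  · rw [hxt t ht']
    congr 1
    refine intervalIntegral.integral_congr fun s hs => ?_
    rw [uIcc_of_le ht] at hs
    exact hcongr s hs

/-- Existence of trajectories on `[0, ∞)`. -/
theorem Data.Regular.exists_trajectory (hS : S.Regular) {x₀ : Vec n} (hx₀ : x₀ ∈ S.G)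
    {u : ℝ → Vec m} (hu : S.IsControl u) : ∃ x, S.IsTrajectory ∞ x₀ u x := by
  choose X hX using fun N : ℕ => hS.exists_trajectory_ofReal hx₀ hu N
  have hmono : ∀ {a b : ℝ≥0∞} {x : ℝ → Vec n}, a ≤ b → S.IsTrajectory b x₀ u x →
      S.IsTrajectory a x₀ u x := fun hab h =>
    ⟨h.1.mono fun t ht => ⟨ht.1, ht.2.trans_le hab⟩, fun t ht hta => h.2 t ht (hta.trans_le hab)⟩
  have huniq : ∀ N k : ℕ, N ≤ k → ∀ t : ℝ, 0 ≤ t → t < N → X N t = X k t := by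
    intro N k hNk t ht htN
    obtain ⟨K, -, -, L, -, h⟩ := hS.exists_lipschitz_dependence (isCompact_singleton (x := x₀))
      (singleton_subset_iff.2 hx₀) t
    have h1 := (h _ x₀ x₀ u (X N) (X k) rfl rfl hu (hX N)
      (hmono (ENNReal.ofReal_le_ofReal (by exact_mod_cast hNk)) (hX k)) t ⟨ht, le_rfl⟩
      (ENNReal.ofReal_lt_ofReal_iff'.2 ⟨htN, ht.trans_lt htN⟩)).2.2
    rw [sub_self, norm_zero, mul_zero] at h1
    exact sub_eq_zero.1 (norm_le_zero_iff.1 h1)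
  -- `X N` is a trajectory only on the half-open `[0, N)`, hence the `+ 1`.
  let x : ℝ → Vec n := fun t => X (⌊t⌋₊ + 1) t
  have hxX : ∀ N : ℕ, ∀ t : ℝ, 0 ≤ t → t < N → x t = X N t := fun N t ht htN =>
    huniq _ _ (Nat.succ_le_of_lt ((Nat.floor_lt ht).2 htN)) t ht
      (by exact_mod_cast Nat.lt_floor_add_one t)
  have hex : ∀ t : ℝ, ∃ N : ℕ, t < N := exists_nat_gt
  refine ⟨x, fun t ht => ?_, fun t ht _ => ?_⟩
  · obtain ⟨N, hN⟩ := hex t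
    have hlt : ∀ s : ℝ, 0 ≤ s → s < N → ENNReal.ofReal s < ENNReal.ofReal (N : ℝ) := fun s h0 h =>
      ENNReal.ofReal_lt_ofReal_iff'.2 ⟨h, h0.trans_lt h⟩
    have h1 : ContinuousWithinAt (X N) (Ico 0 (N : ℝ)) t :=
      ((hX N).1 t ⟨ht.1, hlt t ht.1 hN⟩).mono fun s hs => ⟨hs.1, hlt s hs.1 hs.2⟩
    refine (h1.congr (fun s hs => hxX N s hs.1 hs.2) (hxX N t ht.1 hN)).mono_of_mem_nhdsWithin ?_
    exact mem_nhdsWithin.2 ⟨Iio (N : ℝ), isOpen_Iio, hN, fun s hs => ⟨hs.2.1, hs.1⟩⟩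
  · obtain ⟨N, hN⟩ := hex t
    obtain ⟨h1, h2, h3⟩ := (hX N).2 t ht (ENNReal.ofReal_lt_ofReal_iff'.2 ⟨hN, ht.trans_lt hN⟩)
    have hc : ∀ s ∈ Icc 0 t, S.f (X N s) (u s) = S.f (x s) (u s) := fun s hs => by
      rw [hxX N s hs.1 (hs.2.trans_lt hN)]
    refine ⟨(hxX N t ht hN).symm ▸ h1, h2.congr fun s hs => ?_, ?_⟩
    · rw [uIoc_of_le ht] at hs
      exact hc s ⟨hs.1.le, hs.2⟩
    · rw [hxX N t ht hN, h3]
      congr 1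
      refine intervalIntegral.integral_congr fun s hs => ?_
      rw [uIcc_of_le ht] at hs
      exact hc s hs

/-! ### Concatenation and dynamic programming -/

open Classical in
/-- Follow `a` on `[0, T]` and then `b`, started at time `T`. -/
noncomputable def concat {X : Type*} (T : ℝ) (a b : ℝ → X) : ℝ → X :=
  fun t => if t ≤ T then a t else b (t - T)

theorem concat_of_le {X : Type*} {T t : ℝ} (h : t ≤ T) (a b : ℝ → X) : concat T a b t = a t :=
  if_pos h

theorem concat_of_lt {X : Type*} {T t : ℝ} (h : T < t) (a b : ℝ → X) :
    concat T a b t = b (t - T) :=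
  if_neg (not_le.2 h)

theorem concat_of_ge {X : Type*} {T t : ℝ} {a b : ℝ → X} (hab : b 0 = a T) (h : T ≤ t) :
    concat T a b t = b (t - T) := by
  rcases h.lt_or_eq with h | rfl
  · exact concat_of_lt h a b
  · rw [concat_of_le le_rfl, sub_self, hab]

theorem measurePreserving_sub_restrict (T : ℝ) {J : Set ℝ} (hJ : MeasurableSet J) :
    MeasurePreserving (fun t : ℝ => t - T) (volume.restrict ((fun t : ℝ => t - T) ⁻¹' J))
      (volume.restrict J) :=
  (measurePreserving_sub_right volume T).restrict_preimage hJ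

theorem Data.IsControl.concat (hS : S.Regular) {u v : ℝ → Vec m} (hu : S.IsControl u)
    (hv : S.IsControl v) (T : ℝ) : S.IsControl (concat T u v) := by
  classical
  refine hS.isControl_iff.2 ⟨fun t ht => ?_, ?_⟩
  · rcases le_or_gt t T with h | h
    · rw [concat_of_le h]; exact hu.1 t ht
    · rw [concat_of_lt h]; exact hv.1 _ (sub_pos.2 h).le
  · have hpw : ExitTime.concat T u v = (Iic T).piecewise u fun t => v (t - T) := rfl
    rw [hpw]
    refine AEStronglyMeasurable.piecewise measurableSet_Iic
      ((hS.isControl_iff.1 hu).2.mono_measure Measure.restrict_le_self) ?_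
    refine ((hS.isControl_iff.1 hv).2.comp_measurePreserving
      (measurePreserving_sub_restrict T measurableSet_Ici)).mono_measure ?_
    rw [Measure.restrict_restrict measurableSet_Iic.compl]
    refine Measure.restrict_mono (fun t ht => ?_) le_rfl
    have : T < t := not_le.1 ht.1
    exact sub_nonneg.2 this.le

theorem Data.IsTrajectory.concat {x₀ : Vec n} {u v : ℝ → Vec m} {x y : ℝ → Vec n} {T : ℝ}
    (hT : 0 ≤ T) (hx : S.IsTrajectory ∞ x₀ u x) (hy : S.IsTrajectory ∞ (x T) v y) :
    S.IsTrajectory ∞ x₀ (concat T u v) (concat T x y) := by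
  have hy0 : y 0 = x T := hy.map_zero
  refine ⟨?_, fun t ht _ => ?_⟩
  · have hform : ∀ t, ExitTime.concat T x y t = x (min t T) + (y (max (t - T) 0) - x T) := by
      intro t
      rcases le_total t T with h | h
      · rw [concat_of_le h, min_eq_left h, max_eq_right (sub_nonpos.2 h), hy0]; abel
      · rw [concat_of_ge hy0 h, min_eq_right h, max_eq_left (sub_nonneg.2 h)]; abel
    refine ContinuousOn.congr ?_ fun t _ => hform t
    refine (hx.continuousOn_Ici.comp (by fun_prop) fun t ht => ?_).add
      ((hy.continuousOn_Ici.comp (by fun_prop) fun t ht => ?_).sub continuousOn_const)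
    · exact (le_min ht.1 hT : (0 : ℝ) ≤ min t T)
    · exact (le_max_right _ _ : (0 : ℝ) ≤ max (t - T) 0)
  have hfirst : ∀ s ≤ T, S.f (ExitTime.concat T x y s) (ExitTime.concat T u v s) =
      S.f (x s) (u s) := fun s hs => by rw [concat_of_le hs, concat_of_le hs]
  have hbefore : ∀ s, 0 ≤ s → s ≤ T → IntervalIntegrable
      (fun s => S.f (ExitTime.concat T x y s) (ExitTime.concat T u v s)) volume 0 s ∧
      x s = x₀ + ∫ σ in (0 : ℝ)..s,
        S.f (ExitTime.concat T x y σ) (ExitTime.concat T u v σ) := by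
    intro s h0 hs
    obtain ⟨-, h2, h3⟩ := hx.2 s h0 (by simp)
    refine ⟨h2.congr fun σ hσ => ?_, ?_⟩
    · rw [uIoc_of_le h0] at hσ
      exact (hfirst σ (hσ.2.trans hs)).symm
    · rw [h3]
      congr 1
      refine intervalIntegral.integral_congr fun σ hσ => ?_
      rw [uIcc_of_le h0] at hσ
      exact (hfirst σ (hσ.2.trans hs)).symm
  rcases le_or_gt t T with h | h
  · rw [concat_of_le h]
    exact ⟨(hx.2 t ht (by simp)).1, hbefore t ht h⟩
  · rw [concat_of_lt h]
    obtain ⟨h1, h2, h3⟩ := hy.2 (t - T) (sub_pos.2 h).le (by simp)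
    have hcongr : ∀ s ∈ uIoc T t, S.f (y (s - T)) (v (s - T)) =
        S.f (ExitTime.concat T x y s) (ExitTime.concat T u v s) := fun s hs => by
      rw [uIoc_of_le h.le] at hs
      rw [concat_of_lt hs.1, concat_of_lt hs.1]
    have hi2 : IntervalIntegrable
        (fun s => S.f (ExitTime.concat T x y s) (ExitTime.concat T u v s)) volume T t := by
      have := h2.comp_sub_right T
      rw [zero_add, sub_add_cancel] at this
      exact this.congr hcongr
    obtain ⟨hi1, hx1⟩ := hbefore T hT le_rfl
    refine ⟨h1, hi1.trans hi2, ?_⟩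
    rw [← intervalIntegral.integral_add_adjacent_intervals hi1 hi2, ← add_assoc, ← hx1, h3]
    congr 1
    rw [← intervalIntegral.integral_congr_ae (Eventually.of_forall hcongr),
      intervalIntegral.integral_comp_sub_right (fun s => S.f (y s) (v s)), sub_self]

/-- The general `A` and `J` serve the infinite and the finite horizon at once. An inequality
suffices, and it needs no measurability of the cost. -/
theorem lintegral_concat_le {x y : ℝ → Vec n} {u v : ℝ → Vec m} {T : ℝ} {A J : Set ℝ}
    (hJ : MeasurableSet J) (hA : ∀ t ∈ A, 0 ≤ t) (hAJ : ∀ t ∈ A, T < t → t - T ∈ J) :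
    ∫⁻ t in A, ENNReal.ofReal (S.g (concat T x y t) (concat T u v t)) ≤
      (∫⁻ t in Icc 0 T, ENNReal.ofReal (S.g (x t) (u t))) +
        ∫⁻ t in J, ENNReal.ofReal (S.g (y t) (v t)) := by
  have hsub : A ⊆ Icc 0 T ∪ (Ioi T ∩ (fun t : ℝ => t - T) ⁻¹' J) := fun t ht => by
    rcases le_or_gt t T with h | h
    · exact Or.inl ⟨hA t ht, h⟩
    · exact Or.inr ⟨h, hAJ t ht h⟩
  have hJ' : MeasurableSet ((fun t : ℝ => t - T) ⁻¹' J) := measurable_id.sub_const T hJ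
  refine (lintegral_mono_set hsub).trans ((lintegral_union_le _ _ _).trans (add_le_add ?_ ?_))
  · refine (setLIntegral_congr_fun measurableSet_Icc fun t ht => ?_).le
    simp only [concat_of_le ht.2]
  · rw [setLIntegral_congr_fun (g := fun t => ENNReal.ofReal (S.g (y (t - T)) (v (t - T))))
      (measurableSet_Ioi.inter hJ')
      fun t ht => by simp only [concat_of_lt (mem_Ioi.1 ht.1)]]
    refine (lintegral_mono_set inter_subset_right).trans ?_
    exact ((measurePreserving_sub_right volume T).setLIntegral_comp_preimage_emb
      (MeasurableEquiv.subRight T).measurableEmbedding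
      (fun t => ENNReal.ofReal (S.g (y t) (v t))) J).le

theorem V₀_le_of {x₀ : Vec n} {u : ℝ → Vec m} {x : ℝ → Vec n} (hu : S.IsControl u)
    (hx : S.IsTrajectory ∞ x₀ u x) :
    S.V₀ x₀ ≤ ∫⁻ t in Ici (0 : ℝ), ENNReal.ofReal (S.g (x t) (u t)) :=
  iInf₂_le_of_le u x <| iInf₂_le_of_le hu hx le_rfl

theorem V_le_of {δ : ℝ} {x₀ : Vec n} {u : ℝ → Vec m} {x : ℝ → Vec n} {T : ℝ} (hu : S.IsControl u)
    (hx : S.IsTrajectory ∞ x₀ u x) (hT : 0 ≤ T) (hxT : ‖x T‖ ≤ δ) :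
    S.V δ x₀ ≤ ∫⁻ t in Icc (0 : ℝ) T, ENNReal.ofReal (S.g (x t) (u t)) :=
  iInf₂_le_of_le u x <| iInf_le_of_le T <| iInf₂_le_of_le hu hx <|
    iInf₂_le_of_le hT (mem_closedBall_zero_iff.2 hxT) le_rfl

theorem exists_of_V₀_lt {x₀ : Vec n} {b : ℝ≥0∞} (h : S.V₀ x₀ < b) :
    ∃ u x, S.IsControl u ∧ S.IsTrajectory ∞ x₀ u x ∧
      ∫⁻ t in Ici (0 : ℝ), ENNReal.ofReal (S.g (x t) (u t)) < b := by
  simpa only [Data.V₀, iInf_lt_iff, exists_prop] using h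

theorem exists_of_V_lt {δ : ℝ} {x₀ : Vec n} {b : ℝ≥0∞} (h : S.V δ x₀ < b) :
    ∃ u x T, S.IsControl u ∧ S.IsTrajectory ∞ x₀ u x ∧ 0 ≤ T ∧ ‖x T‖ ≤ δ ∧
      ∫⁻ t in Icc (0 : ℝ) T, ENNReal.ofReal (S.g (x t) (u t)) < b := by
  simpa only [Data.V, iInf_lt_iff, exists_prop, mem_closedBall_zero_iff] using h

theorem V₀_le_add (hS : S.Regular) {x₀ : Vec n} {u : ℝ → Vec m} {x : ℝ → Vec n} {T : ℝ}
    (hu : S.IsControl u) (hx : S.IsTrajectory ∞ x₀ u x) (hT : 0 ≤ T) :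
    S.V₀ x₀ ≤ (∫⁻ t in Icc (0 : ℝ) T, ENNReal.ofReal (S.g (x t) (u t))) + S.V₀ (x T) := by
  -- Moving the first cost to the left by truncated subtraction leaves the infimum alone on the
  -- right.
  rw [← tsub_le_iff_left]
  refine le_iInf₂ fun v y => le_iInf₂ fun hv hy => ?_
  rw [tsub_le_iff_left]
  exact (V₀_le_of (hu.concat hS hv T) (hx.concat hT hy)).trans
    (lintegral_concat_le measurableSet_Ici (fun t ht => ht) fun t _ h => (sub_pos.2 h).le)

theorem V_le_add (hS : S.Regular) {δ : ℝ} {x₀ : Vec n} {u : ℝ → Vec m} {x : ℝ → Vec n} {T : ℝ}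
    (hu : S.IsControl u) (hx : S.IsTrajectory ∞ x₀ u x) (hT : 0 ≤ T) :
    S.V δ x₀ ≤ (∫⁻ t in Icc (0 : ℝ) T, ENNReal.ofReal (S.g (x t) (u t))) + S.V δ (x T) := by
  rw [← tsub_le_iff_left]
  refine le_iInf₂ fun v y => le_iInf fun T' => le_iInf₂ fun hv hy => le_iInf₂ fun hT' hyT => ?_
  rw [tsub_le_iff_left]
  refine (V_le_of (T := T + T') (hu.concat hS hv T) (hx.concat hT hy) (by positivity) ?_).trans
    (lintegral_concat_le measurableSet_Icc (fun t ht => ht.1) fun t ht h =>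
      ⟨(sub_pos.2 h).le, by linarith [ht.2]⟩)
  rw [concat_of_ge hy.map_zero (by linarith), add_sub_cancel_left]
  exact mem_closedBall_zero_iff.1 hyT

theorem mem_D₀_of_trajectory (hS : S.Regular) {x₀ : Vec n} (hx₀ : x₀ ∈ S.G) {u : ℝ → Vec m}
    {x : ℝ → Vec n} {T : ℝ} (hu : S.IsControl u) (hx : S.IsTrajectory ∞ x₀ u x) (hT : 0 ≤ T)
    (hxT : x T ∈ S.D₀) : x₀ ∈ S.D₀ := by
  obtain ⟨-, v, y, hv, hy, hlim⟩ := hxT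
  refine ⟨hx₀, _, _, hu.concat hS hv T, hx.concat hT hy, ?_⟩
  refine (hlim.comp (tendsto_atTop_add_const_right _ (-T) tendsto_id)).congr' ?_
  filter_upwards [eventually_gt_atTop T] with t ht
  rw [concat_of_lt ht]
  rfl

/-! ### Consequences of local controllability -/

variable {r ubar : ℝ} {β : ℝ → ℝ → ℝ} {α₁ α₂ : ℝ → ℝ}

theorem ClassK.nonneg {φ : ℝ → ℝ} (hφ : ClassK φ) {s : ℝ} (hs : 0 ≤ s) : 0 ≤ φ s := by
  rw [← hφ.map_zero]
  exact hφ.strictMonoOn.monotoneOn self_mem_Ici hs hs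

/-- The bound `y ≤ φ s` puts `y` in the range of `φ` by the intermediate value theorem, so `kInv` is
a true inverse at `y`. -/
theorem ClassK.kInv_mem_Icc {φ : ℝ → ℝ} (hφ : ClassK φ) {s y : ℝ} (hs : 0 ≤ s) (hy : 0 ≤ y)
    (hys : y ≤ φ s) : kInv φ y ∈ Icc 0 s := by
  have hex : ∃ a ∈ Ici (0 : ℝ), φ a = y := by
    obtain ⟨a, ha, hay⟩ := intermediate_value_Icc hs (hφ.continuousOn.mono Icc_subset_Ici_self)
      (⟨by rwa [hφ.map_zero], hys⟩ : y ∈ Icc (φ 0) (φ s))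
    exact ⟨a, ha.1, hay⟩
  have h1 : kInv φ y ∈ Ici (0 : ℝ) := Function.invFunOn_mem hex
  have h2 : φ (kInv φ y) = y := Function.invFunOn_eq hex
  exact ⟨h1, (hφ.strictMonoOn.le_iff_le h1 hs).1 (h2.le.trans hys)⟩

/-- A set of full measure is dense. This upgrades the almost-everywhere bound of the small control
property to a bound on the state at every time. -/
theorem forall_le_of_ae_le {a b : ℝ → ℝ} (ha : ContinuousOn a (Ici 0)) (hb : ContinuousOn b (Ici 0))
    (h : ∀ᵐ t ∂(volume.restrict (Ici (0 : ℝ))), a t ≤ b t) {t : ℝ} (ht : 0 ≤ t) : a t ≤ b t := by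
  have hd : Dense {t : ℝ | t ∈ Ici (0 : ℝ) → a t ≤ b t} :=
    Measure.dense_of_ae ((ae_restrict_iff' measurableSet_Ici).1 h)
  have hcl : t ∈ closure (Ioi (0 : ℝ) ∩ {t : ℝ | t ∈ Ici (0 : ℝ) → a t ≤ b t}) := by
    have h1 := closure_mono (hd.open_subset_closure_inter (isOpen_Ioi (a := (0 : ℝ))))
    rw [closure_closure, closure_Ioi] at h1
    exact h1 ht
  have hsub : Ioi (0 : ℝ) ∩ {t : ℝ | t ∈ Ici (0 : ℝ) → a t ≤ b t} ⊆ Ici 0 :=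
    fun s hs => (mem_Ioi.1 hs.1).le
  exact ContinuousWithinAt.closure_le hcl ((ha t ht).mono hsub) ((hb t ht).mono hsub)
    fun s hs => hs.2 (hsub hs)

theorem Data.SmallControl.exists_norm_le (h : S.SmallControl r β) (hβ : ClassKL β)
    {x₀ : Vec n} (hx₀ : x₀ ∈ Metric.ball (0 : Vec n) r) :
    ∃ u x, S.IsControl u ∧ S.IsTrajectory ∞ x₀ u x ∧ ∀ t, 0 ≤ t → ‖x t‖ ≤ β ‖x₀‖ t := by
  obtain ⟨u, x, hu, hx, hae⟩ := h x₀ hx₀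
  refine ⟨u, x, hu, hx, fun t ht => ?_⟩
  refine forall_le_of_ae_le hx.continuousOn_Ici.norm (hβ.classL _ (norm_nonneg _)).continuousOn
    (hae.mono fun s hs => ?_) ht
  linarith [norm_nonneg (u s)]

/-- A common consequence of the two forms of local controllability. -/
def Data.CostControllable (S : Data n m) (r ubar : ℝ) (β : ℝ → ℝ → ℝ) (α₂ : ℝ → ℝ) : Prop :=
  ∃ C C' : ℝ, 0 < C ∧ 0 < C' ∧ ∀ x₀ ∈ Metric.ball (0 : Vec n) r, β ‖x₀‖ 0 ≤ min r ubar →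
    ∃ u x, S.IsControl u ∧ S.IsTrajectory ∞ x₀ u x ∧
      ∀ᵐ t ∂(volume.restrict (Ici (0 : ℝ))),
        ∃ q, 0 ≤ q ∧ q ≤ β ‖x₀‖ t ∧ S.g (x t) (u t) ≤ C * (kInv α₂ q) ^ C'

/-- Here `q` is `‖x t‖`. Since `β` decreases in time, its initial smallness keeps the path in the
ball where the cost bound holds. -/
theorem Data.LocallyControllable.costControllable (h : S.LocallyControllable r ubar β)
    (hc : S.CostBound r ubar α₂) (hβ : ClassKL β) : S.CostControllable r ubar β α₂ := by
  obtain ⟨C, C', hC, hC', hg⟩ := hc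
  refine ⟨C, C', hC, hC', fun x₀ hx₀ hβ0 => ?_⟩
  obtain ⟨u, x, hu, hx, hub, hxb⟩ := h x₀ hx₀
  refine ⟨u, x, hu, hx, ?_⟩
  filter_upwards [hub, ae_restrict_mem measurableSet_Ici] with t htu ht
  refine ⟨‖x t‖, norm_nonneg _, hxb t ht, hg _ (mem_closedBall_zero_iff.2 ?_) _
    ⟨mem_closedBall_zero_iff.2 htu, hu.1 t ht⟩⟩
  exact (hxb t ht).trans (((hβ.classL _ (norm_nonneg _)).antitoneOn self_mem_Ici ht ht).trans
    (hβ0.trans (min_le_left _ _)))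

/-- Here `q` is `‖x t‖ + ‖u t‖`, which controls state and control separately. -/
theorem Data.SmallControl.costControllable (h : S.SmallControl r β)
    (hc : S.SmallControlCostBound r ubar α₂) (hβ : ClassKL β) :
    S.CostControllable r ubar β α₂ := by
  obtain ⟨C, C', hC, hC', hg⟩ := hc
  refine ⟨C, C', hC, hC', fun x₀ hx₀ hβ0 => ?_⟩
  obtain ⟨u, x, hu, hx, hxb⟩ := h x₀ hx₀
  refine ⟨u, x, hu, hx, ?_⟩
  filter_upwards [hxb, ae_restrict_mem measurableSet_Ici] with t htu ht
  have h1 := htu.trans (((hβ.classL _ (norm_nonneg _)).antitoneOn self_mem_Ici ht ht).trans hβ0)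
  refine ⟨‖x t‖ + ‖u t‖, by positivity, htu, hg _ (mem_closedBall_zero_iff.2 ?_) _
    ⟨mem_closedBall_zero_iff.2 ?_, hu.1 t ht⟩⟩
  · linarith [min_le_left r ubar, norm_nonneg (u t)]
  · linarith [min_le_right r ubar, norm_nonneg (x t)]

/-- `V₀` tends to `0` at the origin. -/
theorem Data.CostControllable.V₀_small (h : S.CostControllable r ubar β α₂) (hr : 0 < r)
    (hubar : 0 < ubar) (hβ : ClassKL β) (hα₁ : ClassKInf α₁) (hα₂ : ClassKInf α₂)
    (hβα : ∀ ρ t : ℝ, 0 ≤ ρ → 0 ≤ t → β ρ t ≤ α₂ (α₁ ρ * Real.exp (-t)))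
    {ε : ℝ≥0∞} (hε : 0 < ε) :
    ∃ ρ : ℝ, 0 < ρ ∧ ∀ x₀ : Vec n, ‖x₀‖ ≤ ρ → S.V₀ x₀ ≤ ε := by
  obtain ⟨C, C', hC, hC', hx⟩ := h
  set J : ℝ≥0∞ := ∫⁻ t in Ici (0 : ℝ), ENNReal.ofReal (Real.exp (-C' * t)) with hJ
  have hJtop : J ≠ ∞ := by
    have : IntegrableOn (fun t : ℝ => Real.exp (-C' * t)) (Ici 0) :=
      (integrableOn_Ici_iff_integrableOn_Ioi (by simp)).2 (exp_neg_integrableOn_Ioi 0 hC')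
    exact this.lintegral_lt_top.ne
  have hα0 : Tendsto α₁ (𝓝[≥] 0) (𝓝 0) := by
    have := (hα₁.continuousOn 0 self_mem_Ici).tendsto
    rwa [hα₁.map_zero] at this
  have hlim : Tendsto (fun ρ => ENNReal.ofReal (C * α₁ ρ ^ C') * J) (𝓝[≥] 0) (𝓝 0) := by
    have h1 : Tendsto (fun ρ => C * α₁ ρ ^ C') (𝓝[≥] 0) (𝓝 0) := by
      have := (hα0.rpow_const (p := C') (Or.inr hC'.le)).const_mul C
      rwa [Real.zero_rpow hC'.ne', mul_zero] at this
    have := ENNReal.Tendsto.mul_const (ENNReal.tendsto_ofReal h1) (Or.inr hJtop) (b := J)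
    rwa [ENNReal.ofReal_zero, zero_mul] at this
  have hβ0 : Tendsto (fun ρ => β ρ 0) (𝓝[≥] 0) (𝓝 0) := by
    have := ((hβ.classK 0 le_rfl).continuousOn 0 self_mem_Ici).tendsto
    rwa [(hβ.classK 0 le_rfl).map_zero] at this
  have hev : ∀ᶠ ρ in 𝓝[≥] (0 : ℝ), ENNReal.ofReal (C * α₁ ρ ^ C') * J < ε ∧
      β ρ 0 < min r ubar ∧ ρ < r :=
    (hlim.eventually (gt_mem_nhds hε)).and ((hβ0.eventually (gt_mem_nhds (lt_min hr hubar))).and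
      (mem_nhdsWithin_of_mem_nhds (Iio_mem_nhds hr)))
  obtain ⟨ρ, hρ, hsub⟩ := mem_nhdsGE_iff_exists_Icc_subset.1 hev
  refine ⟨ρ, hρ, fun x₀ hx₀ => ?_⟩
  obtain ⟨h1, h2, h3⟩ := hsub (⟨norm_nonneg _, hx₀⟩ : ‖x₀‖ ∈ Icc 0 ρ)
  obtain ⟨u, x, hu, hxt, hg⟩ := hx x₀ (mem_ball_zero_iff.2 h3) h2.le
  refine (V₀_le_of hu hxt).trans (le_trans ?_ h1.le)
  rw [hJ, ← lintegral_const_mul _ (by fun_prop)]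
  refine lintegral_mono_ae ?_
  filter_upwards [hg, ae_restrict_mem measurableSet_Ici] with t htg ht
  obtain ⟨q, hq0, hqβ, hgq⟩ := htg
  have hα := hα₁.toClassK.nonneg (norm_nonneg x₀)
  have hk := hα₂.toClassK.kInv_mem_Icc (mul_nonneg hα (Real.exp_pos (-t)).le) hq0
    (hqβ.trans (hβα _ _ (norm_nonneg _) ht))
  rw [← ENNReal.ofReal_mul (by positivity)]
  refine ENNReal.ofReal_le_ofReal (hgq.trans ?_)
  rw [mul_assoc]
  refine mul_le_mul_of_nonneg_left ?_ hC.le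
  refine (Real.rpow_le_rpow hk.1 hk.2 hC'.le).trans ?_
  rw [Real.mul_rpow hα (Real.exp_pos _).le, ← Real.exp_mul]
  exact (by rw [show -t * C' = -C' * t by ring])

/-- Points from which the origin is asymptotically reached with a `𝒦ℒ` estimate. -/
def Data.Attractive (S : Data n m) (r : ℝ) (β : ℝ → ℝ → ℝ) : Prop :=
  ∀ x₀ ∈ Metric.ball (0 : Vec n) r, ∃ u x, S.IsControl u ∧ S.IsTrajectory ∞ x₀ u x ∧
    ∀ t, 0 ≤ t → ‖x t‖ ≤ β ‖x₀‖ t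

theorem Data.Attractive.ball_subset_D₀ (h : S.Attractive r β)
    (hrG : Metric.closedBall (0 : Vec n) r ⊆ S.G) (hβ : ClassKL β) :
    Metric.ball (0 : Vec n) r ⊆ S.D₀ := by
  intro x₀ hx₀
  obtain ⟨u, x, hu, hx, hb⟩ := h x₀ hx₀
  refine ⟨hrG (Metric.ball_subset_closedBall hx₀), u, x, hu, hx, ?_⟩
  refine squeeze_zero' (Eventually.of_forall fun _ => norm_nonneg _) ?_
    (hβ.classL _ (norm_nonneg x₀)).tendsto
  filter_upwards [eventually_ge_atTop 0] with t ht using hb t ht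

/-- Attraction is given on the open ball only. From a boundary point, the control of a slightly
contracted point is used until the path is inside the open ball. -/
theorem Data.Attractive.closedBall_subset_D₀ (h : S.Attractive r β) (hS : S.Regular) (hr : 0 < r)
    (hrG : Metric.closedBall (0 : Vec n) r ⊆ S.G) (hβ : ClassKL β) :
    Metric.closedBall (0 : Vec n) r ⊆ S.D₀ := by
  intro x₀ hx₀
  -- The time is chosen for radius `r`, hence for all contracted points: `L` depends on `t₁`, and
  -- `η` on `L`. At time `t₁` both the contracted path's norm and the deviation from it are at most
  -- `r / 2`.
  obtain ⟨t₁, ht₁, ht₁r⟩ : ∃ t₁, 0 ≤ t₁ ∧ β r t₁ < r / 2 := by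
    have := ((hβ.classL r hr.le).tendsto.eventually (gt_mem_nhds (half_pos hr))).and
      (eventually_ge_atTop 0)
    obtain ⟨t, h1, h2⟩ := this.exists
    exact ⟨t, h2, h1⟩
  obtain ⟨K, -, -, L, hL, hdep⟩ :=
    hS.exists_lipschitz_dependence (isCompact_closedBall (0 : Vec n) r) hrG t₁
  set η : ℝ := 1 / (2 * L + 2) with hη
  have hη0 : 0 < η := by positivity
  have hη1 : η < 1 := by rw [hη, div_lt_one (by positivity)]; linarith
  have hηL : L * η < 1 / 2 := by
    rw [hη, mul_one_div, div_lt_div_iff₀ (by positivity) (by norm_num)]; linarith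
  have hx₀r := mem_closedBall_zero_iff.1 hx₀
  have hy₀ : ‖(1 - η) • x₀‖ < r := by
    rw [norm_smul, Real.norm_of_nonneg (by linarith)]
    nlinarith [norm_nonneg x₀]
  obtain ⟨u, y, hu, hy, hyb⟩ := h _ (mem_ball_zero_iff.2 hy₀)
  obtain ⟨x, hx⟩ := hS.exists_trajectory (hrG hx₀) hu
  refine mem_D₀_of_trajectory hS (hrG hx₀) hu hx ht₁ (h.ball_subset_D₀ hrG hβ ?_)
  have hd := (hdep ∞ x₀ _ u x y hx₀ (mem_closedBall_zero_iff.2 hy₀.le) hu hx hy t₁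
    ⟨ht₁, le_rfl⟩ (by simp)).2.2
  have hdiff : ‖x₀ - (1 - η) • x₀‖ = η * ‖x₀‖ := by
    rw [sub_smul, one_smul, sub_sub_cancel, norm_smul, Real.norm_of_nonneg hη0.le]
  rw [hdiff] at hd
  have h2 := hyb t₁ ht₁
  have h3 : β ‖(1 - η) • x₀‖ t₁ ≤ β r t₁ :=
    (hβ.classK t₁ ht₁).strictMonoOn.monotoneOn (norm_nonneg _) hr.le hy₀.le
  have h4 : L * (η * ‖x₀‖) ≤ 1 / 2 * r := by
    rw [← mul_assoc]
    exact mul_le_mul hηL.le hx₀r (norm_nonneg _) (by norm_num)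
  rw [mem_ball_zero_iff]
  have h5 := norm_le_norm_add_norm_sub (y t₁) (x t₁)
  rw [norm_sub_rev] at h5
  linarith

/-! ### Finiteness of the costs and comparison of `V δ` with `V₀` -/

theorem lintegral_Icc_le {h : ℝ → ℝ} {B T : ℝ} (hB : 0 ≤ B) (hh : ∀ t ∈ Icc 0 T, h t ≤ B) :
    ∫⁻ t in Icc 0 T, ENNReal.ofReal (h t) ≤ ENNReal.ofReal (B * T) := by
  refine (setLIntegral_mono' measurableSet_Icc
    (fun t ht => ENNReal.ofReal_le_ofReal (hh t ht))).trans ?_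
  rw [setLIntegral_const, Real.volume_Icc, sub_zero, ENNReal.ofReal_mul hB]

theorem Data.RegularCost.exists_bound (hg : S.RegularCost r ubar) (hU : IsCompact S.U)
    {K : Set (Vec n)} (hK : IsCompact K) (hKG : K ⊆ closure S.G) :
    ∃ B : ℝ, 0 < B ∧ ∀ x ∈ K, ∀ u ∈ S.U, S.g x u ≤ B := by
  obtain ⟨B, hB⟩ := ((hK.prod hU).image_of_continuousOn
    (hg.continuous_g.mono (prod_mono hKG Subset.rfl))).isBounded.exists_norm_le
  refine ⟨max B 1, by positivity, fun x hx u hu => ?_⟩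
  exact (Real.le_norm_self _).trans ((hB _ (mem_image_of_mem _ (mk_mem_prod hx hu))).trans
    (le_max_left _ _))

theorem cost_lt_top (hS : S.Regular) (hg : S.RegularCost r ubar) {x₀ : Vec n} (hx₀ : x₀ ∈ S.G)
    {u : ℝ → Vec m} {x : ℝ → Vec n} (hu : S.IsControl u) (hx : S.IsTrajectory ∞ x₀ u x) (T : ℝ) :
    ∫⁻ t in Icc 0 T, ENNReal.ofReal (S.g (x t) (u t)) < ∞ := by
  obtain ⟨K, hK, hKG, hKx⟩ := hS.exists_isCompact_mem isCompact_singleton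
    (singleton_subset_iff.2 hx₀) T
  obtain ⟨B, hB, hgB⟩ := hg.exists_bound hS.compact_U hK hKG
  exact (lintegral_Icc_le hB.le fun t ht =>
    hgB _ (hKx _ _ _ _ rfl hu hx t ht (by simp)) _ (hu.1 t ht.1)).trans_lt ENNReal.ofReal_lt_top

/-- Otherwise the running cost would stay above a positive constant on a half-line. -/
theorem exists_norm_le_of_cost_lt_top (hS : S.Regular) (hg : S.RegularCost r ubar) {x₀ : Vec n}
    (hx₀ : x₀ ∈ S.G) {u : ℝ → Vec m} {x : ℝ → Vec n} (hu : S.IsControl u)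
    (hx : S.IsTrajectory ∞ x₀ u x)
    (hcost : ∫⁻ t in Ici (0 : ℝ), ENNReal.ofReal (S.g (x t) (u t)) < ∞) {ρ : ℝ} (hρ : 0 < ρ) :
    ∃ T, 0 ≤ T ∧ ‖x T‖ ≤ ρ := by
  by_contra! hcon
  obtain ⟨c, hc, hgc⟩ := hg.inf_pos ρ hρ
  have h1 : ∫⁻ _ in Ici (0 : ℝ), ENNReal.ofReal c ≤
      ∫⁻ t in Ici (0 : ℝ), ENNReal.ofReal (S.g (x t) (u t)) :=
    setLIntegral_mono' measurableSet_Ici fun t ht => ENNReal.ofReal_le_ofReal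
      (hgc _ (subset_closure (hx.mem_G hS hx₀ hu ht)) _ (hu.1 t ht) (hcon t ht).le)
  rw [setLIntegral_const, Real.volume_Ici, ENNReal.mul_top (ENNReal.ofReal_pos.2 hc).ne'] at h1
  exact absurd (h1.trans_lt hcost) (lt_irrefl _)

theorem exists_norm_le_of_mem_D₀ {x₀ : Vec n} (hx₀ : x₀ ∈ S.D₀) {ρ : ℝ} (hρ : 0 < ρ) :
    ∃ u x T, S.IsControl u ∧ S.IsTrajectory ∞ x₀ u x ∧ 0 ≤ T ∧ ‖x T‖ ≤ ρ := by
  obtain ⟨-, u, x, hu, hx, hlim⟩ := hx₀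
  obtain ⟨T, h1, h2⟩ := ((hlim.eventually (gt_mem_nhds hρ)).and (eventually_ge_atTop 0)).exists
  exact ⟨u, x, T, hu, hx, h2, h1.le⟩

theorem V_lt_top_of_mem_D₀ (hS : S.Regular) (hg : S.RegularCost r ubar) {x₀ : Vec n}
    (hx₀ : x₀ ∈ S.D₀) {δ : ℝ} (hδ : 0 < δ) : S.V δ x₀ < ∞ := by
  obtain ⟨u, x, T, hu, hx, hT, hxT⟩ := exists_norm_le_of_mem_D₀ hx₀ hδ
  exact (V_le_of hu hx hT hxT).trans_lt (cost_lt_top hS hg hx₀.1 hu hx T)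

theorem Data.Attractive.D₀_eq_V (h : S.Attractive r β) (hS : S.Regular)
    (hg : S.RegularCost r ubar) (hrG : Metric.closedBall (0 : Vec n) r ⊆ S.G) (hβ : ClassKL β)
    {δ : ℝ} (hδ : δ ∈ Ioc 0 r) : S.D₀ = {x₀ | x₀ ∈ S.G ∧ S.V δ x₀ < ∞} := by
  refine Subset.antisymm (fun x₀ hx₀ => ⟨hx₀.1, V_lt_top_of_mem_D₀ hS hg hx₀ hδ.1⟩) ?_
  rintro x₀ ⟨hx₀, hV⟩
  obtain ⟨u, x, T, hu, hx, hT, hxT, -⟩ := exists_of_V_lt hV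
  exact mem_D₀_of_trajectory hS hx₀ hu hx hT (h.closedBall_subset_D₀ hS (hδ.1.trans_le hδ.2) hrG hβ
    (mem_closedBall_zero_iff.2 (hxT.trans hδ.2)))

theorem V_le_V₀ (hS : S.Regular) (hg : S.RegularCost r ubar) {x₀ : Vec n} (hx₀ : x₀ ∈ S.G)
    {δ : ℝ} (hδ : 0 < δ) : S.V δ x₀ ≤ S.V₀ x₀ := by
  refine le_of_forall_gt fun b hb => ?_
  obtain ⟨u, x, hu, hx, hcost⟩ := exists_of_V₀_lt hb
  obtain ⟨T, hT, hxT⟩ := exists_norm_le_of_cost_lt_top hS hg hx₀ hu hx (hcost.trans_le le_top) hδ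
  exact ((V_le_of hu hx hT hxT).trans (lintegral_mono_set Icc_subset_Ici_self)).trans_lt hcost

theorem V₀_le_V_add (hS : S.Regular) {δ : ℝ} {ε : ℝ≥0∞}
    (hsmall : ∀ y : Vec n, ‖y‖ ≤ δ → S.V₀ y ≤ ε) (x₀ : Vec n) : S.V₀ x₀ ≤ S.V δ x₀ + ε := by
  rw [← tsub_le_iff_right]
  refine le_of_forall_gt fun b hb => ?_
  obtain ⟨u, x, T, hu, hx, hT, hxT, hcost⟩ := exists_of_V_lt hb
  refine lt_of_le_of_lt ?_ hcost
  rw [tsub_le_iff_right]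
  exact (V₀_le_add hS hu hx hT).trans (add_le_add_right (hsmall _ hxT) _)

/-! ### The Kruzhkov transform and uniform convergence -/

theorem kruzhkov_lt_one_iff {a : ℝ≥0∞} : kruzhkov a < 1 ↔ a < ∞ := by
  rw [kruzhkov, lt_top_iff_ne_top]
  split_ifs with h
  · simp [h]
  · simp [h, Real.exp_pos]

theorem abs_toReal_sub_le {a b e : ℝ≥0∞} (he : e ≠ ∞) (ha : a ≠ ∞) (hab : a ≤ b)
    (hba : b ≤ a + e) : |b.toReal - a.toReal| ≤ e.toReal := by
  have hb : b ≠ ∞ := (hba.trans_lt (ENNReal.add_lt_top.2 ⟨ha.lt_top, he.lt_top⟩)).ne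
  rw [abs_of_nonneg (sub_nonneg.2 (ENNReal.toReal_mono hb hab)), sub_le_iff_le_add',
    ← ENNReal.toReal_add ha he]
  exact ENNReal.toReal_mono (ENNReal.add_ne_top.2 ⟨ha, he⟩) hba

theorem abs_kruzhkov_sub_le {a b e : ℝ≥0∞} (he : e ≠ ∞) (hab : a ≤ b) (hba : b ≤ a + e) :
    |kruzhkov b - kruzhkov a| ≤ e.toReal := by
  by_cases ha : a = ∞
  · rw [ha, top_le_iff] at hab
    simp [ha, hab]
  have hb : b ≠ ∞ := (hba.trans_lt (ENNReal.add_lt_top.2 ⟨Ne.lt_top ha, he.lt_top⟩)).ne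
  have h1 := abs_toReal_sub_le he ha hab hba
  have h2 := ENNReal.toReal_mono hb hab
  rw [abs_of_nonneg (sub_nonneg.2 h2)] at h1
  have h3 : Real.exp (-b.toReal) ≤ Real.exp (-a.toReal) := Real.exp_le_exp.2 (neg_le_neg h2)
  rw [kruzhkov, kruzhkov, if_neg ha, if_neg hb, sub_sub_sub_cancel_left,
    abs_of_nonneg (sub_nonneg.2 h3)]
  have h4 : Real.exp (-a.toReal) ≤ 1 := Real.exp_le_one_iff.2 (neg_nonpos.2 ENNReal.toReal_nonneg)
  -- The difference is `e^{-a} (1 - e^{-(b - a)})`, bounded by `b - a` through `1 - e^{-t} ≤ t`.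
  have h5 : Real.exp (-b.toReal) = Real.exp (-a.toReal) * Real.exp (-(b.toReal - a.toReal)) := by
    rw [← Real.exp_add]; ring_nf
  have h6 := Real.add_one_le_exp (-(b.toReal - a.toReal))
  nlinarith [Real.exp_pos (-a.toReal)]

theorem tendstoUniformlyOn_kruzhkov_V (hS : S.Regular) (hg : S.RegularCost r ubar)
    (hsmall : ∀ ε : ℝ≥0∞, 0 < ε → ∃ ρ : ℝ, 0 < ρ ∧ ∀ x₀ : Vec n, ‖x₀‖ ≤ ρ → S.V₀ x₀ ≤ ε) :
    TendstoUniformlyOn (fun (δ : ℝ) x₀ => kruzhkov (S.V δ x₀)) (fun x₀ => kruzhkov (S.V₀ x₀))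
      (𝓝[>] 0) S.G := by
  rw [Metric.tendstoUniformlyOn_iff]
  intro ε hε
  obtain ⟨ρ, hρ, hV⟩ := hsmall (ENNReal.ofReal (ε / 2)) (ENNReal.ofReal_pos.2 (half_pos hε))
  filter_upwards [Ioc_mem_nhdsGT hρ] with δ hδ x₀ hx₀
  rw [Real.dist_eq]
  refine (abs_kruzhkov_sub_le ENNReal.ofReal_ne_top (V_le_V₀ hS hg hx₀ hδ.1)
    (V₀_le_V_add hS (fun y hy => hV y (hy.trans hδ.2)) x₀)).trans_lt ?_
  rw [ENNReal.toReal_ofReal (half_pos hε).le]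
  exact half_lt_self hε

theorem tendstoUniformlyOn_V (hS : S.Regular) (hg : S.RegularCost r ubar)
    (hsmall : ∀ ε : ℝ≥0∞, 0 < ε → ∃ ρ : ℝ, 0 < ρ ∧ ∀ x₀ : Vec n, ‖x₀‖ ≤ ρ → S.V₀ x₀ ≤ ε) :
    TendstoUniformlyOn (fun (δ : ℝ) x₀ => (S.V δ x₀).toReal) (fun x₀ => (S.V₀ x₀).toReal)
      (𝓝[>] 0) S.D₀ := by
  rw [Metric.tendstoUniformlyOn_iff]
  intro ε hε
  obtain ⟨ρ, hρ, hV⟩ := hsmall (ENNReal.ofReal (ε / 2)) (ENNReal.ofReal_pos.2 (half_pos hε))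
  filter_upwards [Ioc_mem_nhdsGT hρ] with δ hδ x₀ hx₀
  rw [Real.dist_eq]
  refine (abs_toReal_sub_le ENNReal.ofReal_ne_top (V_lt_top_of_mem_D₀ hS hg hx₀ hδ.1).ne
    (V_le_V₀ hS hg hx₀.1 hδ.1)
    (V₀_le_V_add hS (fun y hy => hV y (hy.trans hδ.2)) x₀)).trans_lt ?_
  rw [ENNReal.toReal_ofReal (half_pos hε).le]
  exact half_lt_self hε

theorem Data.Attractive.D₀_eq_V₀ (h : S.Attractive r β) (hS : S.Regular)
    (hg : S.RegularCost r ubar) (hr : 0 < r) (hrG : Metric.closedBall (0 : Vec n) r ⊆ S.G)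
    (hβ : ClassKL β)
    (hsmall : ∀ ε : ℝ≥0∞, 0 < ε → ∃ ρ : ℝ, 0 < ρ ∧ ∀ x₀ : Vec n, ‖x₀‖ ≤ ρ → S.V₀ x₀ ≤ ε) :
    S.D₀ = {x₀ | x₀ ∈ S.G ∧ S.V₀ x₀ < ∞} := by
  refine Subset.antisymm (fun x₀ hx₀ => ⟨hx₀.1, ?_⟩) fun x₀ hx₀ => ?_
  · obtain ⟨ρ, hρ, hV⟩ := hsmall 1 one_pos
    exact (V₀_le_V_add hS hV x₀).trans_lt
      (ENNReal.add_lt_top.2 ⟨V_lt_top_of_mem_D₀ hS hg hx₀ hρ, ENNReal.one_lt_top⟩)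
  · rw [h.D₀_eq_V hS hg hrG hβ ⟨hr, le_rfl⟩]
    exact ⟨hx₀.1, (V_le_V₀ hS hg hx₀.1 hr).trans_lt hx₀.2⟩

/-! ### Local Lipschitz continuity under the Petrov condition -/

theorem V_eq_zero {δ : ℝ} (hS : S.Regular) (hU : S.U.Nonempty) {y : Vec n} (hy : y ∈ S.G)
    (hyδ : ‖y‖ ≤ δ) : S.V δ y = 0 := by
  obtain ⟨w, hw⟩ := hU
  obtain ⟨x, hx⟩ := hS.exists_trajectory hy (hS.isControl_const hw)
  have hle : S.V δ y ≤ _ := V_le_of (hS.isControl_const hw) hx le_rfl (by rwa [hx.map_zero])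
  simpa using hle

/-- `V δ` is bounded near the points of `D₀`. -/
theorem exists_V_le_near (hS : S.Regular) (hg : S.RegularCost r ubar) {x₀ : Vec n}
    (hx₀ : x₀ ∈ S.D₀) {δ : ℝ} (hδ : 0 < δ) :
    ∃ ρ M : ℝ, 0 < ρ ∧ 0 < M ∧ Metric.closedBall x₀ ρ ⊆ S.G ∧
      ∀ y ∈ Metric.closedBall x₀ ρ, S.V δ y ≤ ENNReal.ofReal M := by
  obtain ⟨u, x, T, hu, hx, hT, hxT⟩ := exists_norm_le_of_mem_D₀ hx₀ (half_pos hδ)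
  obtain ⟨ρ, hρ, hρG⟩ := Metric.nhds_basis_closedBall.mem_iff.1 (hS.open_G.mem_nhds hx₀.1)
  obtain ⟨K, hK, hKG, L, hL, hdep⟩ :=
    hS.exists_lipschitz_dependence (isCompact_closedBall x₀ ρ) hρG T
  obtain ⟨B, hB, hgB⟩ := hg.exists_bound hS.compact_U hK hKG
  -- The reference path reaches radius `δ / 2`; this radius lets its neighbours deviate by at most
  -- another `δ / 2`.
  have hsub : Metric.closedBall x₀ (min ρ (δ / (2 * L))) ⊆ Metric.closedBall x₀ ρ :=
    Metric.closedBall_subset_closedBall (min_le_left _ _)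
  refine ⟨min ρ (δ / (2 * L)), B * T + 1, lt_min hρ (by positivity), by positivity,
    hsub.trans hρG, fun y₀ hy₀ => ?_⟩
  obtain ⟨y, hy⟩ := hS.exists_trajectory (hρG (hsub hy₀)) hu
  have hd := fun t ht => hdep ∞ y₀ x₀ u y x (hsub hy₀) (Metric.mem_closedBall_self hρ.le) hu hy hx
    t ht (by simp)
  have hyT : ‖y T‖ ≤ δ := by
    have h1 := (hd T ⟨hT, le_rfl⟩).2.2
    have h2 : ‖y₀ - x₀‖ ≤ δ / (2 * L) :=
      (mem_closedBall_iff_norm.1 hy₀).trans (min_le_right _ _)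
    have h3 : L * ‖y₀ - x₀‖ ≤ δ / 2 := by
      calc L * ‖y₀ - x₀‖ ≤ L * (δ / (2 * L)) := mul_le_mul_of_nonneg_left h2 hL.le
        _ = δ / 2 := by field_simp
    linarith [norm_le_norm_add_norm_sub' (y T) (x T)]
  refine (V_le_of hu hy hT hyT).trans ((lintegral_Icc_le hB.le fun t ht =>
    hgB _ (hd t ht).1 _ (hu.1 t ht.1)).trans (ENNReal.ofReal_le_ofReal (by linarith)))

/-- With a constant control the integrand is continuous, so the trajectory is a classical solution.
-/
theorem Data.IsTrajectory.hasDerivAt_const {x₀ : Vec n} {w : Vec m} {x : ℝ → Vec n}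
    (hx : S.IsTrajectory ∞ x₀ (fun _ => w) x) (hS : S.Regular) (hw : w ∈ S.U) {t : ℝ}
    (ht : 0 < t) : HasDerivAt x (S.f (x t) w) t := by
  have hc : ContinuousOn (fun s => S.f (x s) w) (Ioi 0) :=
    hS.continuous_f.comp (f := fun s => (x s, w))
      ((hx.continuousOn_Ici.mono Ioi_subset_Ici_self).prodMk continuousOn_const)
      fun s hs => mk_mem_prod (hx.2 s (mem_Ioi.1 hs).le (by simp)).1 hw
  have h1 : HasDerivAt (fun t => x₀ + ∫ s in (0 : ℝ)..t, S.f (x s) w) (S.f (x t) w) t :=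
    (intervalIntegral.integral_hasDerivAt_right (hx.2 t ht.le (by simp)).2.1
      (hc.stronglyMeasurableAtFilter isOpen_Ioi t ht)
      (hc.continuousAt (Ioi_mem_nhds ht))).const_add x₀
  refine h1.congr_of_eventuallyEq ?_
  filter_upwards [Ioi_mem_nhds ht] with s hs
  exact (hx.2 s (mem_Ioi.1 hs).le (by simp)).2.2

theorem Data.IsTrajectory.norm_sq_le {x₀ : Vec n} {w : Vec m} {x : ℝ → Vec n}
    (hx : S.IsTrajectory ∞ x₀ (fun _ => w) x) (hS : S.Regular) (hw : w ∈ S.U) {κ τ : ℝ}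
    (hκ : ∀ t ∈ Icc 0 τ, inner ℝ (x t) (S.f (x t) w) ≤ -κ) :
    ∀ t ∈ Icc 0 τ, ‖x t‖ ^ 2 ≤ ‖x₀‖ ^ 2 - 2 * κ * t := by
  intro t ht
  have hd : ∀ s ∈ Ioo 0 τ, HasDerivAt (fun s => ‖x s‖ ^ 2 + 2 * κ * s)
      (2 * inner ℝ (x s) (S.f (x s) w) + 2 * κ * 1) s := fun s hs =>
    (hx.hasDerivAt_const hS hw hs.1).norm_sq.add ((hasDerivAt_id s).const_mul (2 * κ))
  have hanti : AntitoneOn (fun s => ‖x s‖ ^ 2 + 2 * κ * s) (Icc 0 τ) := by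
    refine antitoneOn_of_deriv_nonpos (convex_Icc 0 τ) ?_ ?_ ?_
    · exact ((hx.continuousOn_Ici.mono Icc_subset_Ici_self).norm.pow 2).add (by fun_prop)
    · rw [interior_Icc]
      exact fun s hs => (hd s hs).differentiableAt.differentiableWithinAt
    · rw [interior_Icc]
      intro s hs
      rw [(hd s hs).deriv]
      linarith [hκ s ⟨hs.1.le, hs.2.le⟩]
  have := hanti ⟨le_rfl, ht.1.trans ht.2⟩ ht ht.1
  simp only [hx.map_zero, mul_zero, add_zero] at this
  linarith

/-- Under the Petrov condition, `V δ` grows at most linearly near a point of the target boundary. -/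
theorem exists_V_le_near_sphere (hS : S.Regular) (hg : S.RegularCost r ubar) {δ : ℝ} {p : Vec n}
    (hp : ‖p‖ = δ) (hpG : p ∈ S.G) {w : Vec m} (hw : w ∈ S.U) (hpw : inner ℝ p (S.f p w) < 0) :
    ∃ κ : ℝ, ∀ᶠ y in 𝓝 p, S.V δ y ≤ ENNReal.ofReal κ * ENNReal.ofReal (‖y‖ - δ) := by
  have hδ : 0 ≤ δ := hp ▸ norm_nonneg p
  -- Half of the Petrov margin at `p`, which survives in a neighbourhood of `p` with `w` held fixed.
  set κ : ℝ := -inner ℝ p (S.f p w) / 2 with hκdef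
  have hκ : 0 < κ := by rw [hκdef]; linarith
  set B : ℝ := |S.g p w| + 1 with hBdef
  have hB : 0 < B := by positivity
  have hfc : ContinuousAt (fun q => S.f q w) p :=
    (hS.continuous_f.comp (f := fun q => (q, w)) (s := S.G) (by fun_prop) fun q hq =>
      mk_mem_prod (hS.closure_subset (subset_closure hq)) hw).continuousAt (hS.open_G.mem_nhds hpG)
  have hgc : ContinuousAt (fun q => S.g q w) p :=
    (hg.continuous_g.comp (f := fun q => (q, w)) (s := S.G) (by fun_prop) fun q hq =>
      mk_mem_prod (subset_closure hq) hw).continuousAt (hS.open_G.mem_nhds hpG)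
  have hev : ∀ᶠ q in 𝓝 p, q ∈ S.G ∧ inner ℝ q (S.f q w) < -κ ∧ S.g q w < B := by
    have hGp : ∀ᶠ q in 𝓝 p, q ∈ S.G := hS.open_G.mem_nhds hpG
    refine hGp.and (((continuousAt_id.inner (𝕜 := ℝ) hfc).eventually
      (gt_mem_nhds ?_)).and (hgc.eventually (gt_mem_nhds ?_)))
    · simp only [id]; rw [hκdef]; linarith
    · rw [hBdef]; linarith [le_abs_self (S.g p w)]
  obtain ⟨ρ, hρ, hρsub⟩ := Metric.nhds_basis_closedBall.mem_iff.1 hev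
  have hu := hS.isControl_const hw
  obtain ⟨x, hx⟩ := hS.exists_trajectory hpG hu
  obtain ⟨τ, hτ, hxτ⟩ : ∃ τ > 0, ∀ t ∈ Icc 0 τ, ‖x t - p‖ ≤ ρ / 2 := by
    have h0 := (hx.continuousOn_Ici 0 self_mem_Ici).tendsto
    rw [hx.map_zero] at h0
    obtain ⟨τ, hτ, h⟩ := mem_nhdsGE_iff_exists_Icc_subset.1
      (h0 (Metric.closedBall_mem_nhds p (half_pos hρ)))
    exact ⟨τ, hτ, fun t ht => mem_closedBall_iff_norm.1 (h ht)⟩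
  obtain ⟨K, -, -, L, hL, hdep⟩ := hS.exists_lipschitz_dependence (isCompact_closedBall p ρ)
    (fun q hq => (hρsub hq).1) τ
  refine ⟨B * (2 * δ + 1) / (2 * κ), ?_⟩
  have hn : Tendsto (fun y : Vec n => ‖y‖) (𝓝 p) (𝓝 δ) := hp ▸ continuous_norm.tendsto p
  have hn2 : Tendsto (fun y : Vec n => (‖y‖ ^ 2 - δ ^ 2) / (2 * κ)) (𝓝 p) (𝓝 0) := by
    have := ((hn.pow 2).sub_const (δ ^ 2)).div_const (2 * κ)
    rwa [sub_self, zero_div] at this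
  filter_upwards [Metric.closedBall_mem_nhds p hρ,
    Metric.closedBall_mem_nhds p (show 0 < ρ / (2 * L) by positivity),
    hn.eventually (gt_mem_nhds (lt_add_one δ)), hn2.eventually (gt_mem_nhds hτ)] with y hy1 hy2 hy3 hy4
  have hyG := (hρsub hy1).1
  rcases le_or_gt ‖y‖ δ with hyδ | hyδ
  · rw [V_eq_zero hS ⟨w, hw⟩ hyG hyδ]
    exact zero_le
  obtain ⟨z, hz⟩ := hS.exists_trajectory hyG hu
  have hzρ : ∀ t ∈ Icc 0 τ, z t ∈ Metric.closedBall p ρ := fun t ht => by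
    have h1 := (hdep ∞ y p _ z x hy1 (Metric.mem_closedBall_self hρ.le) hu hz hx t ht (by simp)).2.2
    have h2 : L * ‖y - p‖ ≤ ρ / 2 := by
      calc L * ‖y - p‖ ≤ L * (ρ / (2 * L)) :=
            mul_le_mul_of_nonneg_left (mem_closedBall_iff_norm.1 hy2) hL.le
        _ = ρ / 2 := by field_simp
    rw [mem_closedBall_iff_norm]
    linarith [norm_sub_le_norm_sub_add_norm_sub (z t) (x t) p, hxτ t ht]
  -- The time at which the bound `‖y‖² - 2κt` on the squared norm falls to `δ²`. The cost is at most
  -- `B t₁`, and `‖y‖² - δ² ≤ (2δ + 1)(‖y‖ - δ)` because `‖y‖ < δ + 1`.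
  set t₁ := (‖y‖ ^ 2 - δ ^ 2) / (2 * κ) with ht₁def
  have ht₁ : 0 ≤ t₁ := div_nonneg (by nlinarith) (by positivity)
  have hdec := hz.norm_sq_le hS hw (fun t ht => (hρsub (hzρ t ht)).2.1.le) t₁ ⟨ht₁, hy4.le⟩
  have heq : 2 * κ * t₁ = ‖y‖ ^ 2 - δ ^ 2 := by rw [ht₁def]; field_simp
  have hzδ : ‖z t₁‖ ≤ δ := by
    refine le_of_sq_le_sq ?_ hδ
    linarith
  refine (V_le_of hu hz ht₁ hzδ).trans ((lintegral_Icc_le hB.le fun t ht =>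
    (hρsub (hzρ t ⟨ht.1, ht.2.trans hy4.le⟩)).2.2.le).trans ?_)
  rw [← ENNReal.ofReal_mul (by positivity)]
  refine ENNReal.ofReal_le_ofReal ?_
  rw [ht₁def, div_mul_eq_mul_div, mul_div_assoc', mul_assoc]
  refine div_le_div_of_nonneg_right (mul_le_mul_of_nonneg_left ?_ hB.le) (by positivity)
  nlinarith

/-- Compactness of the sphere makes `κ` uniform. Inside the target both sides vanish,
`ENNReal.ofReal` being `0` on negative numbers. -/
theorem exists_V_le_near_target (hS : S.Regular) (hU : S.U.Nonempty) (hg : S.RegularCost r ubar)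
    {δ : ℝ} (hδ : 0 < δ) (hδG : Metric.closedBall (0 : Vec n) δ ⊆ S.G)
    (hP : ∀ x ∈ Metric.sphere (0 : Vec n) δ, ∃ u ∈ S.U, inner ℝ x (S.f x u) < 0) :
    ∃ κ η : ℝ, 0 < κ ∧ 0 < η ∧ ∀ y : Vec n, ‖y‖ < δ + η →
      S.V δ y ≤ ENNReal.ofReal κ * ENNReal.ofReal (‖y‖ - δ) := by
  have key : ∃ κ : ℝ, ∀ᶠ y in 𝓝ˢ (Metric.sphere (0 : Vec n) δ),
      S.V δ y ≤ ENNReal.ofReal κ * ENNReal.ofReal (‖y‖ - δ) := by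
    refine (isCompact_sphere (0 : Vec n) δ).induction_on
      (p := fun s => ∃ κ : ℝ, ∀ᶠ y in 𝓝ˢ s,
        S.V δ y ≤ ENNReal.ofReal κ * ENNReal.ofReal (‖y‖ - δ)) ?_ ?_ ?_ ?_
    · exact ⟨0, by simp⟩
    · exact fun s t hst ⟨κ, h⟩ => ⟨κ, h.filter_mono (nhdsSet_mono hst)⟩
    · rintro s t ⟨κ, hκ⟩ ⟨κ', hκ'⟩
      refine ⟨max κ κ', ?_⟩
      rw [nhdsSet_union, eventually_sup]
      refine ⟨hκ.mono fun y hy => hy.trans ?_, hκ'.mono fun y hy => hy.trans ?_⟩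
      · gcongr; exact le_max_left _ _
      · gcongr; exact le_max_right _ _
    · intro p hp
      obtain ⟨w, hw, hpw⟩ := hP p hp
      obtain ⟨κ, hκ⟩ := exists_V_le_near_sphere hS hg (mem_sphere_zero_iff_norm.1 hp)
        (hδG (Metric.sphere_subset_closedBall hp)) hw hpw
      exact ⟨_, mem_nhdsWithin_of_mem_nhds hκ.eventually_nhds, κ,
        mem_nhdsSet_iff_forall.2 fun y hy => hy⟩
  obtain ⟨κ, hκ⟩ := key
  obtain ⟨W, hW, hWs, hWκ⟩ := mem_nhdsSet_iff_exists.1 hκ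
  obtain ⟨η, hη, hηW⟩ := (isCompact_sphere (0 : Vec n) δ).exists_thickening_subset_open hW hWs
  refine ⟨max κ 1, η, by positivity, hη, fun y hy => ?_⟩
  rcases le_or_gt ‖y‖ δ with hyδ | hyδ
  · rw [V_eq_zero hS hU (hδG (mem_closedBall_zero_iff.2 hyδ)) hyδ]
    exact zero_le
  have hy0 : 0 < ‖y‖ := hδ.trans hyδ
  have hmem : y ∈ Metric.thickening η (Metric.sphere (0 : Vec n) δ) := by
    rw [Metric.mem_thickening_iff]
    -- The radial projection to the sphere is at distance `‖y‖ - δ`.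
    refine ⟨(δ / ‖y‖) • y, ?_, ?_⟩
    · rw [mem_sphere_zero_iff_norm, norm_smul, Real.norm_of_nonneg (by positivity)]
      field_simp
    · have h1 : y - (δ / ‖y‖) • y = (1 - δ / ‖y‖) • y := by rw [sub_smul, one_smul]
      have h2 : 0 ≤ 1 - δ / ‖y‖ := sub_nonneg.2 ((div_le_one hy0).2 hyδ.le)
      rw [dist_eq_norm, h1, norm_smul, Real.norm_of_nonneg h2, sub_mul, div_mul_cancel₀ _ hy0.ne']
      linarith
  refine (hWκ (hηW hmem)).trans ?_
  gcongr
  exact le_max_left _ _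

/-- Stopping at the first hit does not raise the cost and keeps the path outside the target, where
`g` is bounded below; this is what bounds the hitting time. -/
theorem exists_first_hitting {δ : ℝ} {x₀ : Vec n} {b : ℝ≥0∞} (h : S.V δ x₀ < b) :
    ∃ u x T, S.IsControl u ∧ S.IsTrajectory ∞ x₀ u x ∧ 0 ≤ T ∧ ‖x T‖ ≤ δ ∧
      (∀ t ∈ Ico 0 T, δ < ‖x t‖) ∧
      ∫⁻ t in Icc (0 : ℝ) T, ENNReal.ofReal (S.g (x t) (u t)) < b := by
  obtain ⟨u, x, T, hu, hx, hT, hxT, hcost⟩ := exists_of_V_lt h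
  have hcl : IsClosed (Icc 0 T ∩ (fun t => ‖x t‖) ⁻¹' Iic δ) :=
    (hx.continuousOn_Ici.mono Icc_subset_Ici_self).norm.preimage_isClosed_of_isClosed isClosed_Icc
      isClosed_Iic
  obtain ⟨s, ⟨hs, hxs⟩, hmin⟩ := (isCompact_Icc.of_isClosed_subset hcl inter_subset_left).exists_isLeast
    ⟨T, ⟨hT, le_rfl⟩, hxT⟩
  refine ⟨u, x, s, hu, hx, hs.1, hxs, fun t ht => ?_,
    (lintegral_mono_set (Icc_subset_Icc_right hs.2)).trans_lt hcost⟩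
  by_contra hcon
  exact absurd (hmin ⟨⟨ht.1, ht.2.le.trans hs.2⟩, not_lt.1 hcon⟩) (not_le.2 ht.2)

theorem exists_lipschitzOnWith_V (hS : S.Regular) (hU : S.U.Nonempty) (hg : S.RegularCost r ubar)
    {δ : ℝ} (hδ : 0 < δ) (hδG : Metric.closedBall (0 : Vec n) δ ⊆ S.G)
    (hP : ∀ x ∈ Metric.sphere (0 : Vec n) δ, ∃ u ∈ S.U, inner ℝ x (S.f x u) < 0)
    {x₀ : Vec n} (hx₀ : x₀ ∈ S.D₀) :
    ∃ (ρ : ℝ) (Λ : NNReal), 0 < ρ ∧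
      LipschitzOnWith Λ (fun y => (S.V δ y).toReal) (Metric.ball x₀ ρ) := by
  obtain ⟨ρ₀, M, hρ₀, hM, hG, hV⟩ := exists_V_le_near hS hg hx₀ hδ
  obtain ⟨κ, η, hκ, hη, hVκ⟩ := exists_V_le_near_target hS hU hg hδ hδG hP
  obtain ⟨c, hc, hgc⟩ := hg.inf_pos δ hδ
  -- A control of cost below `M + 1`, paying at least `c` per unit of time, hits the target before
  -- `Tm`.
  set Tm : ℝ := (M + 1) / c with hTm
  have hTm0 : 0 < Tm := by positivity
  obtain ⟨K, hK, hKG, L, hL, hdep⟩ :=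
    hS.exists_lipschitz_dependence (isCompact_closedBall x₀ ρ₀) hG Tm
  obtain ⟨R, hR, hKR⟩ := hK.isBounded.subset_closedBall_lt 0 0
  obtain ⟨Cg, hCg, hgLip⟩ := hg.lipschitz_g R hR
  -- Two points of the ball are less than `2ρ` apart, so the final gap stays below `η`, where the
  -- Petrov estimate is valid.
  set ρ := min ρ₀ (η / (2 * L)) with hρdef
  have hρ : 0 < ρ := lt_min hρ₀ (by positivity)
  -- The first term bounds the change of running cost up to time `Tm`, the second the price of
  -- closing the final gap.
  set Λ : ℝ := Cg * L * Tm + κ * L with hΛ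
  have hΛ0 : 0 < Λ := by positivity
  have hsub : ∀ y ∈ Metric.ball x₀ ρ, y ∈ Metric.closedBall x₀ ρ₀ := fun y hy =>
    Metric.ball_subset_closedBall (Metric.ball_subset_ball (min_le_left _ _) hy)
  have key : ∀ p ∈ Metric.ball x₀ ρ, ∀ q ∈ Metric.ball x₀ ρ,
      S.V δ q ≤ S.V δ p + ENNReal.ofReal (Λ * ‖p - q‖) := by
    intro p hp q hq
    rw [← tsub_le_iff_right]
    refine le_of_forall_gt fun b hb => ?_
    have hlt : S.V δ p < min b (ENNReal.ofReal (M + 1)) :=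
      lt_min hb ((hV p (hsub p hp)).trans_lt
        ((ENNReal.ofReal_lt_ofReal_iff (by positivity)).2 (lt_add_one M)))
    obtain ⟨u, x, T, hu, hx, hT, hxT, hxout, hcost⟩ := exists_first_hitting hlt
    refine lt_of_le_of_lt ?_ (hcost.trans_le (min_le_left _ _))
    rw [tsub_le_iff_right]
    have hTTm : T ≤ Tm := by
      have h1 : ∫⁻ _ in Ico 0 T, ENNReal.ofReal c ≤
          ∫⁻ t in Icc 0 T, ENNReal.ofReal (S.g (x t) (u t)) :=
        (setLIntegral_mono' measurableSet_Ico fun t ht => ENNReal.ofReal_le_ofReal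
          (hgc _ (subset_closure (hx.mem_G hS (hG (hsub p hp)) hu ht.1)) _ (hu.1 t ht.1)
            (hxout t ht).le)).trans (lintegral_mono_set Ico_subset_Icc_self)
      rw [setLIntegral_const, Real.volume_Ico, sub_zero, ← ENNReal.ofReal_mul hc.le] at h1
      have h2 := h1.trans_lt (hcost.trans_le (min_le_right _ _))
      rw [ENNReal.ofReal_lt_ofReal_iff (by positivity)] at h2
      rw [hTm, le_div_iff₀ hc]
      linarith
    obtain ⟨y, hy⟩ := hS.exists_trajectory (hG (hsub q hq)) hu
    have hd := fun t (ht : t ∈ Icc 0 T) => hdep ∞ p q u x y (hsub p hp) (hsub q hq) hu hx hy t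
      ⟨ht.1, ht.2.trans hTTm⟩ (by simp)
    have hgle : ∀ t ∈ Icc 0 T, S.g (y t) (u t) ≤ S.g (x t) (u t) + Cg * (L * ‖p - q‖) := by
      intro t ht
      obtain ⟨hxK, hyK, hxy⟩ := hd t ht
      have h1 := hgLip _ ⟨hKR hyK, hKG hyK⟩ _ ⟨hKR hxK, hKG hxK⟩ _ (hu.1 t ht.1)
      have h2 := mul_le_mul_of_nonneg_left hxy hCg.le
      rw [norm_sub_rev] at h1
      linarith [le_abs_self (S.g (y t) (u t) - S.g (x t) (u t))]
    have hint : ∫⁻ t in Icc 0 T, ENNReal.ofReal (S.g (y t) (u t)) ≤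
        (∫⁻ t in Icc 0 T, ENNReal.ofReal (S.g (x t) (u t))) +
          ENNReal.ofReal (Cg * L * Tm * ‖p - q‖) := by
      refine (setLIntegral_mono' measurableSet_Icc fun t ht =>
        (ENNReal.ofReal_le_ofReal (hgle t ht)).trans ENNReal.ofReal_add_le).trans ?_
      rw [lintegral_add_right _ measurable_const]
      refine add_le_add_right ((lintegral_Icc_le (by positivity) fun _ _ => le_rfl).trans
        (ENNReal.ofReal_le_ofReal ?_)) _
      calc Cg * (L * ‖p - q‖) * T ≤ Cg * (L * ‖p - q‖) * Tm :=
            mul_le_mul_of_nonneg_left hTTm (by positivity)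
        _ = Cg * L * Tm * ‖p - q‖ := by ring
    have hyT : ‖y T‖ ≤ δ + L * ‖p - q‖ := by
      have h1 := (hd T ⟨hT, le_rfl⟩).2.2
      linarith [norm_le_norm_add_norm_sub (x T) (y T)]
    have hyη : ‖y T‖ < δ + η := by
      have h1 : ‖p - q‖ < ρ + ρ := by
        have h2 := mem_ball_iff_norm.1 hp
        have h3 := mem_ball_iff_norm'.1 hq
        exact (norm_sub_le_norm_sub_add_norm_sub p x₀ q).trans_lt (add_lt_add h2 h3)
      have h2 : L * (ρ + ρ) ≤ η := by
        have h3 : ρ ≤ η / (2 * L) := min_le_right _ _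
        calc L * (ρ + ρ) ≤ L * (η / (2 * L) + η / (2 * L)) := by gcongr
          _ = η := by field_simp; ring
      have h3 := mul_lt_mul_of_pos_left h1 hL
      linarith
    have hVy : S.V δ (y T) ≤ ENNReal.ofReal (κ * L * ‖p - q‖) := by
      refine (hVκ _ hyη).trans ?_
      rw [← ENNReal.ofReal_mul hκ.le, mul_assoc]
      exact ENNReal.ofReal_le_ofReal (mul_le_mul_of_nonneg_left (by linarith) hκ.le)
    refine (V_le_add hS hu hy hT).trans ((add_le_add hint hVy).trans ?_)
    rw [add_assoc, ← ENNReal.ofReal_add (by positivity) (by positivity), hΛ, add_mul]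
  have hfin : ∀ p ∈ Metric.ball x₀ ρ, S.V δ p ≠ ∞ := fun p hp =>
    ((hV p (hsub p hp)).trans_lt ENNReal.ofReal_lt_top).ne
  have hreal : ∀ p ∈ Metric.ball x₀ ρ, ∀ q ∈ Metric.ball x₀ ρ,
      (S.V δ q).toReal ≤ (S.V δ p).toReal + Λ * ‖p - q‖ := by
    intro p hp q hq
    have h1 := ENNReal.toReal_mono (ENNReal.add_ne_top.2 ⟨hfin p hp, ENNReal.ofReal_ne_top⟩)
      (key p hp q hq)
    rwa [ENNReal.toReal_add (hfin p hp) ENNReal.ofReal_ne_top,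
      ENNReal.toReal_ofReal (by positivity)] at h1
  refine ⟨ρ, Λ.toNNReal, hρ, LipschitzOnWith.of_dist_le_mul fun p hp q hq => ?_⟩
  rw [Real.coe_toNNReal _ hΛ0.le, Real.dist_eq, dist_eq_norm, abs_sub_le_iff]
  have h1 := hreal p hp q hq
  have h2 := hreal q hq p hp
  rw [norm_sub_rev] at h2
  constructor <;> linarith

/-! ### Differentiability almost everywhere -/

/-- Rademacher's theorem applies on each ball, and second countability lets null sets be recognized
locally. -/
theorem ae_differentiableAt_of_locally_lipschitz {E F : Type*} [NormedAddCommGroup E]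
    [NormedSpace ℝ E] [FiniteDimensional ℝ E] [MeasurableSpace E] [BorelSpace E]
    [NormedAddCommGroup F] [NormedSpace ℝ F] [FiniteDimensional ℝ F]
    (μ : Measure E) [μ.IsAddHaarMeasure] {h : E → F} {D : Set E}
    (hD : ∀ x ∈ D, ∃ (ρ : ℝ) (Λ : NNReal), 0 < ρ ∧ LipschitzOnWith Λ h (Metric.ball x ρ)) :
    ∀ᵐ x ∂μ, x ∈ D → DifferentiableAt ℝ h x := by
  rw [ae_iff]
  have : SecondCountableTopology E := have := FiniteDimensional.proper_real E; inferInstance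
  refine measure_null_of_locally_null _ fun x hx => ?_
  obtain ⟨ρ, Λ, hρ, hL⟩ := hD x (by by_contra hcon; exact hx fun h => absurd h hcon)
  refine ⟨_, inter_mem_nhdsWithin _ (Metric.ball_mem_nhds x hρ), ?_⟩
  refine measure_mono_null (fun y hy => ?_) (ae_iff.1 (hL.ae_differentiableWithinAt_of_mem (μ := μ)))
  intro hcon
  exact hy.1 fun _ => (hcon hy.2).differentiableAt (Metric.isOpen_ball.mem_nhds hy.2)

end

end ExitTime

/-! ### Assembly of the four claims -/

theorem theorem3p9 {n m : ℕ} (S : Data n m) (r ubar : ℝ) (β : ℝ → ℝ → ℝ) (α₁ α₂ : ℝ → ℝ)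
    (hS : S.Regular)
    (hU : (0 : Vec m) ∈ S.U) (hf : S.f 0 0 = 0)
    (hr : 0 < r) (hubar : 0 < ubar) (hrG : Metric.closedBall (0 : Vec n) r ⊆ S.G)
    (hβ : ClassKL β) (hα₁ : ClassKInf α₁) (hα₂ : ClassKInf α₂)
    (hβα : ∀ ρ t : ℝ, 0 ≤ ρ → 0 ≤ t → β ρ t ≤ α₂ (α₁ ρ * Real.exp (-t)))
    (hctrl : (S.LocallyControllable r ubar β ∧ S.CostBound r ubar α₂) ∨
      (S.SmallControl r β ∧ ubar = β r 0 ∧ S.SmallControlCostBound r ubar α₂))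
    (hg : S.RegularCost r ubar) :
    -- finiteness exactly on `D₀`
    ((S.D₀ = {x₀ | x₀ ∈ S.G ∧ S.V₀ x₀ < ∞} ∧ S.D₀ = {x₀ | x₀ ∈ S.G ∧ kruzhkov (S.V₀ x₀) < 1}) ∧
      ∀ δ ∈ Ioc 0 r, S.D₀ = {x₀ | x₀ ∈ S.G ∧ S.V δ x₀ < ∞} ∧
        S.D₀ = {x₀ | x₀ ∈ S.G ∧ kruzhkov (S.V δ x₀) < 1}) ∧
    -- uniform convergence of the transforms on `G`
    TendstoUniformlyOn (fun (δ : ℝ) x₀ => kruzhkov (S.V δ x₀)) (fun x₀ => kruzhkov (S.V₀ x₀))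
      (𝓝[>] 0) S.G ∧
    -- uniform convergence of the values on compact subsets of `D₀`
    (∀ K : Set (Vec n), IsCompact K → K ⊆ S.D₀ →
      TendstoUniformlyOn (fun (δ : ℝ) x₀ => (S.V δ x₀).toReal) (fun x₀ => (S.V₀ x₀).toReal)
        (𝓝[>] 0) K) ∧
    -- local Lipschitz continuity and differentiability almost everywhere
    (∀ δ ∈ Ioc 0 r,
      (∀ x ∈ Metric.sphere (0 : Vec n) δ, ∃ u ∈ S.U, inner ℝ x (S.f x u) < 0) →
      LocallyLipschitzOn S.D₀ (fun x₀ => (S.V δ x₀).toReal) ∧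
      ∀ᵐ x₀ ∂(volume : Measure (Vec n)), x₀ ∈ S.D₀ →
        DifferentiableAt ℝ (fun x₀ => (S.V δ x₀).toReal) x₀) := by
  have hA : S.Attractive r β := by
    rcases hctrl with ⟨h, -⟩ | ⟨h, -, -⟩
    · exact fun x₀ hx₀ => (h x₀ hx₀).imp fun u => Exists.imp fun x hx => ⟨hx.1, hx.2.1, hx.2.2.2⟩
    · exact fun x₀ hx₀ => h.exists_norm_le hβ hx₀
  have hC : S.CostControllable r ubar β α₂ := by
    rcases hctrl with ⟨h, hc⟩ | ⟨h, -, hc⟩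
    · exact h.costControllable hc hβ
    · exact h.costControllable hc hβ
  have hsmall : ∀ ε : ℝ≥0∞, 0 < ε → ∃ ρ : ℝ, 0 < ρ ∧ ∀ x₀ : Vec n, ‖x₀‖ ≤ ρ → S.V₀ x₀ ≤ ε :=
    fun ε hε => hC.V₀_small hr hubar hβ hα₁ hα₂ hβα hε
  have hD₀ := hA.D₀_eq_V₀ hS hg hr hrG hβ hsmall
  refine ⟨⟨⟨hD₀, by simpa only [kruzhkov_lt_one_iff] using hD₀⟩, fun δ hδ => ?_⟩,
    tendstoUniformlyOn_kruzhkov_V hS hg hsmall,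
    fun K _ hK => (tendstoUniformlyOn_V hS hg hsmall).mono hK, fun δ hδ hP => ?_⟩
  · have hD := hA.D₀_eq_V hS hg hrG hβ hδ
    exact ⟨hD, by simpa only [kruzhkov_lt_one_iff] using hD⟩
  · have hLip := fun x₀ (hx₀ : x₀ ∈ S.D₀) => exists_lipschitzOnWith_V hS ⟨0, hU⟩ hg hδ.1
      ((Metric.closedBall_subset_closedBall hδ.2).trans hrG) hP hx₀
    refine ⟨fun x₀ hx₀ => ?_, ae_differentiableAt_of_locally_lipschitz volume hLip⟩
    obtain ⟨ρ, Λ, hρ, hL⟩ := hLip x₀ hx₀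
    exact ⟨Λ, _, mem_nhdsWithin_of_mem_nhds (Metric.ball_mem_nhds x₀ hρ), hL⟩
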